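/- Let $r\ge 2$ and let $\mathbb F_r=\langle a_1,\dots,a_r\rangle$ be the free group of rank $r$, with word length $|\cdot|$ relative to the free generators and spheres $S_n=\{\gamma\in\mathbb F_r : |\gamma|=n\}$. Let $X$ be its Cayley graph with respect to $\{a_1^{\pm1},\dots,a_r^{\pm1}\}$, a tree with the path metric $d$ for which every edge has length $1$, let $x_0$ be the vertex given by the identity, and let $\mathbf B$ be the set of right-infinite reduced words in the letters $a_i^{\pm1}$. For $x\in X$ let $\lfloor x\rfloor\in\mathbb F_r$ be the element such that $\lfloor x\rfloor x_0$ is the vertex of the geodesic $[x_0,x]$ closest to $x$. The space $\overline X=X\cup\mathbf B$ carries the topology in which a point of $X$ has its neighbourhoods in $X$ as a basis of neighbourhoods, and $\xi\in\mathbf B$ has as a basis of neighbourhoods the sets $C_u=\{x\in X : u\text{ is a prefix of }\lfloor x\rfloor\}\cup\{\eta\in\mathbf B : u\text{ is a prefix of }\eta\}$, where $u$ runs over the finite prefixes of $\xi$. Let $\mu$ be the Borel probability measure on $\mathbf B$ such that the set of infinite words with prefix $u$ has measure $\frac{1}{2r(2r-1)^{|u|-1}}$ for every $u\in\mathbb F_r\setminus\{e\}$,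 and let $L^2(\mathbf B)=L^2(\mathbf B,\mu;\mathbb C)$. For $\xi=u_1u_2\cdots\in\mathbf B$ and $x,y\in X$ let $\beta_\xi(x,y)=\lim_{n\to\infty}\big(d(x,u_1\cdots u_nx_0)-d(y,u_1\cdots u_nx_0)\big)$, and for $\gamma\in\mathbb F_r$ let $P(\gamma,\xi)=(2r-1)^{\beta_\xi(x_0,\gamma x_0)}$. Let $\pi$ be the quasi-regular (unitary) representation of $\mathbb F_r$ on $L^2(\mathbf B)$, $(\pi(\gamma)g)(\xi)=P(\gamma,\xi)^{1/2}g(\gamma^{-1}\xi)$, and let $\Xi(\gamma)=\int_{\mathbf B}P(\gamma,\xi)^{1/2}\,d\mu(\xi)$ be the Harish-Chandra function. For a continuous function $f:\overline X\to\mathbb C$ let $$M_n(f)=\frac1{|S_n|}\sum_{\gamma\in S_n}f(\gamma x_0)\,\frac{\pi(\gamma)}{\Xi(\gamma)},\qquad M(f)=m(f|_{\mathbf B})\,P_{\mathbf 1_{\mathbf B}},$$ where $m(f|_{\mathbf B})$ is the operator of multiplication by $f|_{\mathbf B}$ on $L^2(\mathbf B)$ and $P_{\mathbf 1_{\mathbf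 B}}$ is the orthogonal projection of $L^2(\mathbf B)$ onto the constant functions. **Theorem.** For every $f\in C(\overline X)$, $M_n(f)\to M(f)$ in the weak operator topology as $n\to\infty$. In other words, for every $f\in C(\overline X)$ and all $g,h\in L^2(\mathbf B)$, $$\frac1{|S_n|}\sum_{\gamma\in S_n}f(\gamma x_0)\,\frac{\langle\pi(\gamma)g,h\rangle}{\Xi(\gamma)}\ \xrightarrow[n\to\infty]{}\ \langle M(f)g,h\rangle .$$ -/

import Mathlib

noncomputable section

namespace FreeBoundary

open MeasureTheory Filter Topology
open scoped ENNReal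

/-! ### The Cayley tree as a metric space -/

/-- The point at distance `t` from `g` on the edge from `g` to `g aᵢ`, in barycentric coordinates
with respect to the vertices. -/
def edgeFun {r : ℕ} (g : FreeGroup (Fin r)) (i : Fin r) (t : ℝ) : FreeGroup (Fin r) → ℝ :=
  Pi.single g (1 - t) + Pi.single (g * FreeGroup.of i) t

/-- The (geometric realization of the) Cayley graph `X` of the free group of rank `r` with respect
to `a₁^{±1}, …, a_r^{±1}`: a point is a vertex, or lies on an edge joining `g` to `g aᵢ`.
Points are given by their barycentric coordinates. -/
def CayleyTree (r : ℕ) : Type :=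
  {x : FreeGroup (Fin r) → ℝ // (∃ g, x = Pi.single g 1) ∨
    ∃ (g : FreeGroup (Fin r)) (i : Fin r), ∃ t ∈ Set.Icc (0 : ℝ) 1, x = edgeFun g i t}

/-- The vertex of the Cayley graph given by a group element. -/
def vertex {r : ℕ} (g : FreeGroup (Fin r)) : CayleyTree r := ⟨Pi.single g 1, Or.inl ⟨g, rfl⟩⟩

/-- The point at distance `t` from `g` on the edge from `g` to `g aᵢ`. -/
def edgePoint {r : ℕ} (g : FreeGroup (Fin r)) (i : Fin r) (t : Set.Icc (0 : ℝ) 1) : CayleyTree r :=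
  ⟨edgeFun g i t, Or.inr ⟨g, i, t, t.2, rfl⟩⟩

/-- `EdgePath x y ℓ`: there is a path from `x` to `y` of length `ℓ` made of finitely many segments,
each of them contained in one edge (all edges have length `1`). -/
inductive EdgePath {r : ℕ} : CayleyTree r → CayleyTree r → ℝ → Prop
  | nil (x : CayleyTree r) : EdgePath x x 0
  | cons (g : FreeGroup (Fin r)) (i : Fin r) (s t : Set.Icc (0 : ℝ) 1) {z : CayleyTree r} {ℓ : ℝ} :
      EdgePath (edgePoint g i t) z ℓ → EdgePath (edgePoint g i s) z (|(s : ℝ) - t| + ℓ)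

variable {r : ℕ}

theorem EdgePath.nonneg {x y : CayleyTree r} {ℓ : ℝ} (h : EdgePath x y ℓ) : 0 ≤ ℓ := by
  induction h with
  | nil => exact le_rfl
  | cons g i s t _ ih => positivity

theorem EdgePath.trans {x y z : CayleyTree r} {ℓ m : ℝ} (h : EdgePath x y ℓ)
    (h' : EdgePath y z m) : EdgePath x z (ℓ + m) := by
  induction h with
  | nil => simpa using h'
  | cons g i s t _ ih => rw [add_assoc]; exact .cons g i s t (ih h')

theorem EdgePath.single (g : FreeGroup (Fin r)) (i : Fin r) (s t : Set.Icc (0 : ℝ) 1) :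
    EdgePath (edgePoint g i s) (edgePoint g i t) |(s : ℝ) - t| := by
  simpa using EdgePath.cons g i s t (.nil _)

theorem EdgePath.symm {x y : CayleyTree r} {ℓ : ℝ} (h : EdgePath x y ℓ) : EdgePath y x ℓ := by
  induction h with
  | nil => exact .nil _
  | cons g i s t _ ih => rw [add_comm, abs_sub_comm]; exact ih.trans (.single g i t s)

theorem EdgePath.abs_sub_le {x y : CayleyTree r} {ℓ : ℝ} (h : EdgePath x y ℓ) (F : CayleyTree r → ℝ)
    (hF : ∀ g i (s t : Set.Icc (0 : ℝ) 1),
      |F (edgePoint g i s) - F (edgePoint g i t)| ≤ |(s : ℝ) - t|) : |F x - F y| ≤ ℓ := by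
  induction h with
  | nil => simp
  | cons g i s t _ ih =>
    exact (_root_.abs_sub_le _ (F (edgePoint g i t)) _).trans (add_le_add (hF g i s t) ih)

theorem edgePoint_zero (g : FreeGroup (Fin r)) (i : Fin r) :
    edgePoint g i ⟨0, by simp⟩ = vertex g := by
  apply Subtype.ext; simp [edgePoint, vertex, edgeFun]

theorem edgePoint_one (g : FreeGroup (Fin r)) (i : Fin r) :
    edgePoint g i ⟨1, by simp⟩ = vertex (g * FreeGroup.of i) := by
  apply Subtype.ext; simp [edgePoint, vertex, edgeFun]

theorem edgePath_letter (g : FreeGroup (Fin r)) (a : Fin r × Bool) :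
    EdgePath (vertex g) (vertex (g * FreeGroup.mk [a])) 1 := by
  obtain ⟨i, b⟩ := a
  cases b
  · have h := (EdgePath.single (g * FreeGroup.mk [(i, false)]) i ⟨1, by simp⟩ ⟨0, by simp⟩)
    rw [edgePoint_zero, edgePoint_one] at h
    have e : g * FreeGroup.mk [(i, false)] * FreeGroup.of i = g := by
      have : FreeGroup.mk [(i, false)] = (FreeGroup.of i)⁻¹ := rfl
      rw [this]; group
    rw [e] at h
    simpa using h
  · have h := (EdgePath.single g i ⟨0, by simp⟩ ⟨1, by simp⟩)
    rw [edgePoint_zero, edgePoint_one] at h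
    change EdgePath (vertex g) (vertex (g * FreeGroup.of i)) 1
    simpa using h

theorem edgePath_word (g : FreeGroup (Fin r)) (L : List (Fin r × Bool)) :
    EdgePath (vertex g) (vertex (g * FreeGroup.mk L)) L.length := by
  induction L generalizing g with
  | nil =>
    have : g * FreeGroup.mk [] = g := by rw [← FreeGroup.one_eq_mk, mul_one]
    rw [this]; simpa using EdgePath.nil _
  | cons a L ih =>
    have h := (edgePath_letter g a).trans (ih _)
    rw [mul_assoc, FreeGroup.mul_mk] at h
    simpa [add_comm] using h

theorem edgePath_vertex (g h : FreeGroup (Fin r)) :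
    EdgePath (vertex g) (vertex h) (FreeGroup.norm (g⁻¹ * h)) := by
  have := edgePath_word g (g⁻¹ * h).toWord
  rw [FreeGroup.mk_toWord, mul_inv_cancel_left] at this
  exact this

theorem exists_edgePath (x y : CayleyTree r) : ∃ ℓ, EdgePath x y ℓ := by
  have key : ∀ x : CayleyTree r, ∃ g ℓ, EdgePath x (vertex g) ℓ := by
    rintro ⟨x, ⟨g, rfl⟩ | ⟨g, i, t, ht, rfl⟩⟩
    · exact ⟨g, 0, .nil _⟩
    · have := EdgePath.single g i ⟨t, ht⟩ ⟨0, by simp⟩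
      rw [edgePoint_zero] at this
      exact ⟨g, _, this⟩
  obtain ⟨g, ℓ, h⟩ := key x
  obtain ⟨g', ℓ', h'⟩ := key y
  exact ⟨_, (h.trans (edgePath_vertex g g')).trans h'.symm⟩

theorem ne_mul_of (g : FreeGroup (Fin r)) (i : Fin r) : g ≠ g * FreeGroup.of i := by
  intro h
  exact FreeGroup.of_ne_one i (mul_eq_left.1 h.symm)

theorem edgePoint_coord (v g : FreeGroup (Fin r)) (i : Fin r) (s t : Set.Icc (0 : ℝ) 1) :
    |(edgePoint g i s).1 v - (edgePoint g i t).1 v| ≤ |(s : ℝ) - t| := by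
  have hne := ne_mul_of g i
  by_cases h1 : v = g
  · subst h1
    simp [edgePoint, edgeFun, hne]
    rw [abs_sub_comm]
  · by_cases h2 : v = g * FreeGroup.of i
    · subst h2
      simp [edgePoint, edgeFun]
    · simp [edgePoint, edgeFun, h1, h2]

/-- The length metric: the distance of two points is the infimum of the lengths of the paths that
join them. -/
instance : MetricSpace (CayleyTree r) where
  dist x y := sInf {ℓ | EdgePath x y ℓ}
  dist_self x := le_antisymm (csInf_le ⟨0, fun _ h => h.nonneg⟩ (.nil x))
    (le_csInf ⟨0, .nil x⟩ fun _ h => EdgePath.nonneg h)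
  dist_comm x y := by
    congr 1; ext ℓ; exact ⟨EdgePath.symm, EdgePath.symm⟩
  dist_triangle x y z := by
    have hb : ∀ x y : CayleyTree r, BddBelow {ℓ | EdgePath x y ℓ} := fun x y =>
      ⟨0, fun _ h => h.nonneg⟩
    refine le_of_forall_pos_le_add fun ε hε => ?_
    obtain ⟨ℓ, h, hl⟩ := Real.lt_sInf_add_pos (s := {ℓ | EdgePath x y ℓ}) (exists_edgePath x y)
      (half_pos hε)
    obtain ⟨m, h', hm⟩ := Real.lt_sInf_add_pos (s := {ℓ | EdgePath y z ℓ}) (exists_edgePath y z)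
      (half_pos hε)
    have := csInf_le (hb x z) (EdgePath.trans h h')
    linarith
  eq_of_dist_eq_zero := by
    intro x y h
    apply Subtype.ext
    funext v
    by_contra hne
    have hpos : 0 < |x.1 v - y.1 v| := abs_pos.2 (sub_ne_zero.2 hne)
    have : |x.1 v - y.1 v| ≤ sInf {ℓ | EdgePath x y ℓ} :=
      le_csInf (exists_edgePath x y) fun ℓ hℓ =>
        EdgePath.abs_sub_le hℓ (fun x => x.1 v) (edgePoint_coord v)
    change sInf {ℓ | EdgePath x y ℓ} = 0 at h
    linarith

/-- On vertices the distance is the word metric. -/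
theorem dist_vertex (g h : FreeGroup (Fin r)) :
    dist (vertex g) (vertex h) = FreeGroup.norm (g⁻¹ * h) := by
  refine le_antisymm (csInf_le ⟨0, fun _ h => h.nonneg⟩ (edgePath_vertex g h)) ?_
  refine le_csInf (exists_edgePath _ _) fun ℓ hℓ => ?_
  let F : CayleyTree r → ℝ := fun x => ∑ᶠ w, x.1 w * (FreeGroup.norm (g⁻¹ * w) : ℝ)
  have hFe : ∀ k i (t : Set.Icc (0 : ℝ) 1), F (edgePoint k i t) =
      (1 - t) * (FreeGroup.norm (g⁻¹ * k) : ℝ) +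
        t * (FreeGroup.norm (g⁻¹ * (k * FreeGroup.of i)) : ℝ) := by
    intro k i t
    have hne := ne_mul_of k i
    have : F (edgePoint k i t) = ∑ w ∈ {k, k * FreeGroup.of i},
        (edgePoint k i t).1 w * (FreeGroup.norm (g⁻¹ * w) : ℝ) := by
      apply finsum_eq_sum_of_support_subset
      intro w hw
      by_contra hcon
      simp only [Finset.coe_insert, Finset.coe_singleton, Set.mem_insert_iff,
        Set.mem_singleton_iff, not_or] at hcon
      apply hw
      simp [edgePoint, edgeFun, hcon.1, hcon.2]
    rw [this, Finset.sum_pair hne]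
    simp [edgePoint, edgeFun, hne, hne.symm]
  have hFv : ∀ k, F (vertex k) = (FreeGroup.norm (g⁻¹ * k) : ℝ) := by
    intro k
    have : F (vertex k) = ∑ w ∈ {k}, (vertex k).1 w * (FreeGroup.norm (g⁻¹ * w) : ℝ) := by
      apply finsum_eq_sum_of_support_subset
      intro w hw
      by_contra hcon
      simp only [Finset.coe_singleton, Set.mem_singleton_iff] at hcon
      apply hw
      simp [vertex, hcon]
    rw [this]; simp [vertex]
  have hl := EdgePath.abs_sub_le hℓ F (by
    intro k i s t
    rw [hFe, hFe]
    set A := (FreeGroup.norm (g⁻¹ * k) : ℝ) with hA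
    set B := (FreeGroup.norm (g⁻¹ * (k * FreeGroup.of i)) : ℝ) with hB
    have h1 : B ≤ A + 1 := by
      have := FreeGroup.norm_mul_le (g⁻¹ * k) (FreeGroup.of i)
      rw [FreeGroup.norm_of, mul_assoc] at this
      rw [hA, hB]
      exact_mod_cast this
    have h2 : A ≤ B + 1 := by
      have := FreeGroup.norm_mul_le (g⁻¹ * (k * FreeGroup.of i)) (FreeGroup.of i)⁻¹
      rw [FreeGroup.norm_inv_eq, FreeGroup.norm_of, mul_assoc, mul_assoc, mul_inv_cancel,
        mul_one] at this
      rw [hA, hB]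
      exact_mod_cast this
    have : (1 - (s : ℝ)) * A + s * B - ((1 - t) * A + t * B) = (s - t) * (B - A) := by ring
    rw [this, abs_mul]
    exact mul_le_of_le_one_right (abs_nonneg _) (abs_le.2 ⟨by linarith, by linarith⟩))
  rw [hFv, hFv] at hl
  have := (neg_abs_le _).trans' (neg_le_neg hl)
  simp at this
  simpa using this

/-- The natural action of the free group on its Cayley tree, `(γ x)(v) = x(γ⁻¹ v)` in barycentric
coordinates. It maps the vertex `g` to the vertex `γ g`. -/
instance : MulAction (FreeGroup (Fin r)) (CayleyTree r) where
  smul γ x := ⟨fun v => x.1 (γ⁻¹ * v), by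
    have hs : ∀ (g : FreeGroup (Fin r)) (t : ℝ), (fun v => (Pi.single g t :
        FreeGroup (Fin r) → ℝ) (γ⁻¹ * v)) = Pi.single (γ * g) t := by
      intro g t
      funext v
      simp only [Pi.single_apply, inv_mul_eq_iff_eq_mul]
    obtain ⟨x, ⟨g, rfl⟩ | ⟨g, i, t, ht, rfl⟩⟩ := x
    · exact Or.inl ⟨γ * g, hs g 1⟩
    · refine Or.inr ⟨γ * g, i, t, ht, ?_⟩
      funext v
      have h2 := congrFun (hs (g * FreeGroup.of i) t) v
      rw [← mul_assoc] at h2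
      exact congrArg₂ (· + ·) (congrFun (hs g (1 - t)) v) h2⟩
  one_smul x := Subtype.ext (funext fun v => by
    change x.1 (1⁻¹ * v) = x.1 v
    simp)
  mul_smul a b x := Subtype.ext (funext fun v => by
    change x.1 ((a * b)⁻¹ * v) = x.1 (b⁻¹ * (a⁻¹ * v))
    simp [mul_assoc])

theorem smul_vertex (γ g : FreeGroup (Fin r)) : γ • vertex g = vertex (γ * g) := by
  apply Subtype.ext
  funext v
  change (Pi.single g 1 : FreeGroup (Fin r) → ℝ) (γ⁻¹ * v) =
    (Pi.single (γ * g) 1 : FreeGroup (Fin r) → ℝ) v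
  simp only [Pi.single_apply, inv_mul_eq_iff_eq_mul]

/-- The base vertex `x₀` of the Cayley tree. -/
def basePoint (r : ℕ) : CayleyTree r := vertex 1

/-- The geodesic `[x, y]`. -/
def geodesic (x y : CayleyTree r) : Set (CayleyTree r) := {z | dist x z + dist z y = dist x y}

/-- `IsFloor x g`: the vertex `⌊x⌋` of `[x₀, x]` that is closest to `x` is `g x₀`. -/
def IsFloor (x : CayleyTree r) (g : FreeGroup (Fin r)) : Prop :=
  vertex g ∈ geodesic (basePoint r) x ∧
    ∀ h, vertex h ∈ geodesic (basePoint r) x → dist (vertex g) x ≤ dist (vertex h) x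

/-! ### The boundary and the compactification -/

/-- The boundary `B`: right-infinite reduced words on the letters `aᵢ^{±1}`; as in Mathlib's
`FreeGroup`, `(i, true)` stands for `aᵢ` and `(i, false)` for `aᵢ⁻¹`. It carries the topology
(and the Borel sets) of the product of the discrete spaces of letters. -/
def Boundary (r : ℕ) : Type :=
  {ξ : ℕ → Fin r × Bool // ∀ n, (ξ n).1 = (ξ (n + 1)).1 → (ξ n).2 = (ξ (n + 1)).2}

instance : TopologicalSpace (Boundary r) := instTopologicalSpaceSubtype
instance : MeasurableSpace (Boundary r) := Subtype.instMeasurableSpace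
instance : BorelSpace (Boundary r) := Subtype.borelSpace _
instance : SecondCountableTopology (Boundary r) :=
  TopologicalSpace.Subtype.secondCountableTopology _

instance : CompactSpace (Boundary r) := by
  apply isCompact_iff_compactSpace.1
  apply IsClosed.isCompact
  have : {ξ : ℕ → Fin r × Bool | ∀ n, (ξ n).1 = (ξ (n + 1)).1 → (ξ n).2 = (ξ (n + 1)).2} =
      ⋂ n, (fun ξ : ℕ → Fin r × Bool => (ξ n, ξ (n + 1))) ⁻¹'
        {p | p.1.1 = p.2.1 → p.1.2 = p.2.2} := by
    ext ξ; simp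
  change IsClosed {ξ : ℕ → Fin r × Bool | ∀ n, (ξ n).1 = (ξ (n + 1)).1 → (ξ n).2 = (ξ (n + 1)).2}
  rw [this]
  exact isClosed_iInter fun n => (isClosed_discrete _).preimage
    ((continuous_apply n).prodMk (continuous_apply (n + 1)))

/-- The prefix of length `n` of `ξ`, as an element of the free group. -/
def Boundary.pre (ξ : Boundary r) (n : ℕ) : FreeGroup (Fin r) :=
  FreeGroup.mk (List.ofFn fun i : Fin n => ξ.1 i)

/-- `u` is a prefix of the infinite word `ξ`. -/
def Boundary.HasPrefix (u : FreeGroup (Fin r)) (ξ : Boundary r) : Prop :=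
  ∃ n, u = ξ.pre n

theorem Boundary.toWord_pre (ξ : Boundary r) (n : ℕ) :
    (ξ.pre n).toWord = List.ofFn fun i : Fin n => ξ.1 i := by
  rw [pre, FreeGroup.toWord_mk]
  apply FreeGroup.IsReduced.reduce_eq
  rw [FreeGroup.IsReduced, List.isChain_ofFn]
  intro i hi
  exact ξ.2 i

theorem Boundary.norm_pre (ξ : Boundary r) (n : ℕ) : (ξ.pre n).norm = n := by
  rw [FreeGroup.norm, toWord_pre, List.length_ofFn]

theorem Boundary.pre_prefix (ξ : Boundary r) {n m : ℕ} (h : n ≤ m) :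
    (ξ.pre n).toWord <+: (ξ.pre m).toWord := by
  rw [toWord_pre, toWord_pre, List.prefix_iff_eq_take]
  apply List.ext_getElem
  · simp [h]
  · intro i h1 h2; simp

theorem Boundary.HasPrefix.of_prefix {u v : FreeGroup (Fin r)} {ξ : Boundary r}
    (hv : ξ.HasPrefix v) (h : u.toWord <+: v.toWord) : ξ.HasPrefix u := by
  obtain ⟨n, rfl⟩ := hv
  refine ⟨u.norm, FreeGroup.toWord_injective ?_⟩
  have hl : u.norm ≤ n := (ξ.norm_pre n) ▸ h.length_le
  exact (List.prefix_of_prefix_length_le h (ξ.pre_prefix hl)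
    (by rw [← FreeGroup.norm, ← FreeGroup.norm, ξ.norm_pre])).eq_of_length
    (by rw [← FreeGroup.norm, ← FreeGroup.norm, ξ.norm_pre])

/-- `X̄ = X ∪ B`. -/
inductive Compactification (r : ℕ) : Type
  | ofTree : CayleyTree r → Compactification r
  | ofBoundary : Boundary r → Compactification r

/-- `C_u = X_u ∪ B_u`, where `X_u` is the set of all `x ∈ X` such that `u` is a prefix of `⌊x⌋` and
`B_u` the set of all `ξ ∈ B` such that `u` is a prefix of `ξ`. -/
def cone (u : FreeGroup (Fin r)) : Set (Compactification r) :=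
  Compactification.ofTree '' {x | ∃ g, IsFloor x g ∧ u.toWord <+: g.toWord} ∪
    Compactification.ofBoundary '' {ξ | ξ.HasPrefix u}

theorem cone_anti {u v : FreeGroup (Fin r)} (h : u.toWord <+: v.toWord) : cone v ⊆ cone u := by
  rintro _ (⟨x, ⟨g, hg, hv⟩, rfl⟩ | ⟨ξ, hξ, rfl⟩)
  · exact Or.inl ⟨x, ⟨g, hg, h.trans hv⟩, rfl⟩
  · exact Or.inr ⟨ξ, hξ.of_prefix h, rfl⟩

/-- The topology of `X̄`: a point of `X` has its neighbourhoods in `X` as a basis of neighbourhoods,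
and `ξ ∈ B` has the sets `C_u`, for the prefixes `u` of `ξ`. -/
instance : TopologicalSpace (Compactification r) where
  IsOpen U := IsOpen (Compactification.ofTree ⁻¹' U) ∧
    ∀ ξ : Boundary r, Compactification.ofBoundary ξ ∈ U → ∃ u, ξ.HasPrefix u ∧ cone u ⊆ U
  isOpen_univ := ⟨isOpen_univ, fun ξ _ => ⟨1, ⟨0, rfl⟩, Set.subset_univ _⟩⟩
  isOpen_inter := by
    rintro U V ⟨hU, hU'⟩ ⟨hV, hV'⟩
    refine ⟨hU.inter hV, fun ξ hξ => ?_⟩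
    obtain ⟨_, ⟨n, rfl⟩, hn⟩ := hU' ξ hξ.1
    obtain ⟨_, ⟨m, rfl⟩, hm⟩ := hV' ξ hξ.2
    exact ⟨_, ⟨max n m, rfl⟩, Set.subset_inter
      ((cone_anti (ξ.pre_prefix (le_max_left n m))).trans hn)
      ((cone_anti (ξ.pre_prefix (le_max_right n m))).trans hm)⟩
  isOpen_sUnion := by
    intro S hS
    refine ⟨?_, fun ξ hξ => ?_⟩
    · rw [Set.preimage_sUnion]
      exact isOpen_biUnion fun U hU => (hS U hU).1
    · obtain ⟨U, hU, hξU⟩ := hξ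
      obtain ⟨u, hu, hu'⟩ := (hS U hU).2 ξ hξU
      exact ⟨u, hu, hu'.trans (Set.subset_sUnion_of_mem hU)⟩

/-! ### The action on the boundary -/

/-- The inverse of a letter. -/
def invLetter (a : Fin r × Bool) : Fin r × Bool := (a.1, !a.2)

theorem ne_invLetter_iff {a b : Fin r × Bool} : b ≠ invLetter a ↔ (a.1 = b.1 → a.2 = b.2) := by
  obtain ⟨i, s⟩ := a
  obtain ⟨j, t⟩ := b
  simp only [invLetter, ne_eq, Prod.mk.injEq, not_and]
  cases s <;> cases t <;> simp <;> tauto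

@[simp] theorem invLetter_invLetter (a : Fin r × Bool) : invLetter (invLetter a) = a := by
  simp [invLetter]

theorem Boundary.ne_inv (ξ : Boundary r) (n : ℕ) : ξ.1 (n + 1) ≠ invLetter (ξ.1 n) :=
  ne_invLetter_iff.2 (ξ.2 n)

/-- Delete the first letter. -/
def Boundary.tail (ξ : Boundary r) : Boundary r := ⟨fun n => ξ.1 (n + 1), fun n => ξ.2 (n + 1)⟩

/-- Put the letter `a` in front of a word that does not begin with `a⁻¹`. -/
def Boundary.cons (a : Fin r × Bool) (ξ : Boundary r) (h : ξ.1 0 ≠ invLetter a) : Boundary r :=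
  ⟨fun n => Nat.casesOn n a ξ.1, fun n => by
    cases n with
    | zero => exact ne_invLetter_iff.1 h
    | succ n => exact ξ.2 n⟩

/-- Left multiplication of an infinite reduced word by a letter, followed by reduction. -/
def Boundary.letterMul (a : Fin r × Bool) (ξ : Boundary r) : Boundary r :=
  if h : ξ.1 0 = invLetter a then ξ.tail else ξ.cons a h

theorem Boundary.letterMul_of_eq {a : Fin r × Bool} {ξ : Boundary r} (h : ξ.1 0 = invLetter a) :
    ξ.letterMul a = ξ.tail := dif_pos h

theorem Boundary.letterMul_of_ne {a : Fin r × Bool} {ξ : Boundary r} (h : ξ.1 0 ≠ invLetter a) :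
    ξ.letterMul a = ξ.cons a h := dif_neg h

theorem Boundary.letterMul_letterMul (a : Fin r × Bool) (ξ : Boundary r) :
    (ξ.letterMul a).letterMul (invLetter a) = ξ := by
  by_cases h : ξ.1 0 = invLetter a
  · have h' : ξ.tail.1 0 ≠ invLetter (invLetter a) := by rw [← h]; exact ξ.ne_inv 0
    rw [letterMul_of_eq h, letterMul_of_ne h']
    apply Subtype.ext
    funext n
    cases n with
    | zero => exact h.symm
    | succ n => rfl
  · have h' : (ξ.cons a h).1 0 = invLetter (invLetter a) := by rw [invLetter_invLetter]; rfl
    rw [letterMul_of_ne h, letterMul_of_eq h']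
    rfl

/-- The generator `aᵢ` acting on the boundary. -/
def generatorPerm (i : Fin r) : Equiv.Perm (Boundary r) where
  toFun := Boundary.letterMul (i, true)
  invFun := Boundary.letterMul (i, false)
  left_inv := Boundary.letterMul_letterMul (i, true)
  right_inv := Boundary.letterMul_letterMul (i, false)

/-- The action of the free group on its boundary, by left multiplication and reduction. -/
instance : MulAction (FreeGroup (Fin r)) (Boundary r) :=
  MulAction.compHom (Boundary r) (FreeGroup.lift (generatorPerm (r := r)))

theorem letter_smul (a : Fin r × Bool) (ξ : Boundary r) :
    FreeGroup.mk [a] • ξ = ξ.letterMul a := by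
  change FreeGroup.lift (generatorPerm (r := r)) (FreeGroup.mk [a]) ξ = ξ.letterMul a
  obtain ⟨i, b⟩ := a
  rw [FreeGroup.lift_mk]
  cases b <;> simp [generatorPerm] <;> rfl

theorem inv_letter (a : Fin r × Bool) :
    (FreeGroup.mk [a])⁻¹ = FreeGroup.mk [invLetter a] := by
  simp [invLetter, FreeGroup.invRev]

theorem mk_cons (a : Fin r × Bool) (L : List (Fin r × Bool)) :
    FreeGroup.mk (a :: L) = FreeGroup.mk [a] * FreeGroup.mk L := by
  rw [FreeGroup.mul_mk]; rfl

theorem Boundary.pre_zero (ξ : Boundary r) : ξ.pre 0 = 1 := rfl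

theorem Boundary.pre_succ (ξ : Boundary r) (n : ℕ) :
    ξ.pre (n + 1) = FreeGroup.mk [ξ.1 0] * ξ.tail.pre n := by
  rw [pre, List.ofFn_succ, mk_cons]
  rfl

theorem Boundary.pre_letterMul_of_eq {a : Fin r × Bool} {ξ : Boundary r} (h : ξ.1 0 = invLetter a)
    (n : ℕ) : (ξ.letterMul a).pre n = FreeGroup.mk [a] * ξ.pre (n + 1) := by
  rw [letterMul_of_eq h, pre_succ, h, ← inv_letter, mul_inv_cancel_left]

theorem Boundary.pre_letterMul_of_ne {a : Fin r × Bool} {ξ : Boundary r} (h : ξ.1 0 ≠ invLetter a)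
    (n : ℕ) : (ξ.letterMul a).pre (n + 1) = FreeGroup.mk [a] * ξ.pre n := by
  rw [letterMul_of_ne h, pre_succ]
  rfl

/-! ### The Busemann function -/

/-- The Busemann function `β_ξ(x, y)`: the limit of the (eventually constant) sequence
`d(x, ξ₁⋯ξₙ) - d(y, ξ₁⋯ξₙ)`. -/
def busemann (ξ : Boundary r) (x y : CayleyTree r) : ℝ :=
  limUnder atTop fun n : ℕ => dist x (vertex (ξ.pre n)) - dist y (vertex (ξ.pre n))

/-- `P(γ, ξ) = (2r - 1)^{β_ξ(x₀, γ x₀)}`. -/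
def poisson (γ : FreeGroup (Fin r)) (ξ : Boundary r) : ℝ :=
  (2 * (r : ℝ) - 1) ^ busemann ξ (basePoint r) (γ • basePoint r)

theorem busemann_eq {γ : FreeGroup (Fin r)} {ξ : Boundary r} {c : ℝ}
    (h : ∀ᶠ n : ℕ in atTop, (n : ℝ) - (γ⁻¹ * ξ.pre n).norm = c) :
    busemann ξ (basePoint r) (γ • basePoint r) = c := by
  apply Tendsto.limUnder_eq
  apply tendsto_const_nhds.congr'
  filter_upwards [h] with n hn
  rw [basePoint, smul_vertex, dist_vertex, dist_vertex, mul_one, inv_one, one_mul, ξ.norm_pre, hn]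

/-- The Busemann function of a letter. -/
def letterBusemann (a : Fin r × Bool) (ξ : Boundary r) : ℝ := if ξ.1 0 = a then 1 else -1

theorem busemann_step {a : Fin r × Bool} {γ : FreeGroup (Fin r)} {ξ : Boundary r} {c : ℝ}
    (h : ∀ᶠ n : ℕ in atTop,
      (n : ℝ) - (γ⁻¹ * (ξ.letterMul (invLetter a)).pre n).norm = c) :
    ∀ᶠ n : ℕ in atTop, (n : ℝ) - ((FreeGroup.mk [a] * γ)⁻¹ * ξ.pre n).norm =
      letterBusemann a ξ + c := by
  have e : ∀ n, (FreeGroup.mk [a] * γ)⁻¹ * ξ.pre n =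
      γ⁻¹ * (FreeGroup.mk [invLetter a] * ξ.pre n) := by
    intro n; rw [← inv_letter]; group
  simp only [e]
  by_cases h0 : ξ.1 0 = a
  · have h1 : ξ.1 0 = invLetter (invLetter a) := by simpa using h0
    rw [letterBusemann, if_pos h0]
    rw [← map_add_atTop_eq_nat 1, eventually_map]
    filter_upwards [h] with n hn
    rw [← Boundary.pre_letterMul_of_eq h1]
    push_cast
    linarith
  · have h1 : ξ.1 0 ≠ invLetter (invLetter a) := by simpa using h0
    rw [letterBusemann, if_neg h0]
    filter_upwards [(tendsto_add_atTop_nat 1).eventually h] with n hn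
    rw [← Boundary.pre_letterMul_of_ne h1]
    push_cast at hn
    linarith

theorem exists_busemann (γ : FreeGroup (Fin r)) (ξ : Boundary r) :
    ∃ c : ℝ, ∀ᶠ n : ℕ in atTop, (n : ℝ) - (γ⁻¹ * ξ.pre n).norm = c := by
  rw [← FreeGroup.mk_toWord (x := γ)]
  generalize γ.toWord = L
  induction L generalizing ξ with
  | nil =>
    refine ⟨0, Eventually.of_forall fun n => ?_⟩
    rw [← FreeGroup.one_eq_mk, inv_one, one_mul, ξ.norm_pre, sub_self]
  | cons a L ih =>
    obtain ⟨c, hc⟩ := ih (ξ.letterMul (invLetter a))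
    rw [mk_cons]
    exact ⟨_, busemann_step hc⟩

theorem busemann_mul (a : Fin r × Bool) (γ : FreeGroup (Fin r)) (ξ : Boundary r) :
    busemann ξ (basePoint r) ((FreeGroup.mk [a] * γ) • basePoint r) = letterBusemann a ξ +
      busemann (ξ.letterMul (invLetter a)) (basePoint r) (γ • basePoint r) := by
  obtain ⟨c, hc⟩ := exists_busemann γ (ξ.letterMul (invLetter a))
  rw [busemann_eq hc, busemann_eq (busemann_step hc)]

theorem busemann_one (ξ : Boundary r) :
    busemann ξ (basePoint r) ((1 : FreeGroup (Fin r)) • basePoint r) = 0 := by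
  apply busemann_eq
  exact Eventually.of_forall fun n => by rw [inv_one, one_mul, ξ.norm_pre, sub_self]

/-- The cocycle identity of the Busemann function. -/
theorem busemann_cocycle (γ γ' : FreeGroup (Fin r)) (ξ : Boundary r) :
    busemann ξ (basePoint r) ((γ * γ') • basePoint r) =
      busemann ξ (basePoint r) (γ • basePoint r) +
        busemann (γ⁻¹ • ξ) (basePoint r) (γ' • basePoint r) := by
  rw [← FreeGroup.mk_toWord (x := γ)]
  generalize γ.toWord = L
  induction L generalizing ξ with
  | nil => rw [← FreeGroup.one_eq_mk, busemann_one, one_mul, inv_one, one_smul, zero_add]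
  | cons a L ih =>
    rw [mk_cons, mul_assoc, busemann_mul, busemann_mul, ih, mul_inv_rev, mul_smul, inv_letter,
      letter_smul, add_assoc]

/-! ### The measure on the boundary -/

/-- The word with first letter `s` whose successive letters are picked by `k`: given a letter `b` of
the word, `k n ≠ s⁻¹` determines the next letter, any one different from `b⁻¹`, through the
transposition of `s⁻¹` and `b⁻¹`. -/
def pickSeq (s : Fin r × Bool) (k : ℕ → {a : Fin r × Bool // a ≠ invLetter s}) : ℕ → Fin r × Bool
  | 0 => s
  | n + 1 => Equiv.swap (invLetter s) (invLetter (pickSeq s k n)) (k n)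

/-- `pickSeq` as an element of the boundary. -/
def pickWord (s : Fin r × Bool) (k : ℕ → {a : Fin r × Bool // a ≠ invLetter s}) : Boundary r :=
  ⟨pickSeq s k, fun n => ne_invLetter_iff.1 fun h => (k n).2 <| by
    rw [pickSeq] at h
    exact (Equiv.swap _ _).injective (h.trans (Equiv.swap_apply_left _ _).symm)⟩

instance (s : Fin r × Bool) : Nonempty {a : Fin r × Bool // a ≠ invLetter s} :=
  ⟨⟨s, by rw [ne_invLetter_iff]; simp⟩⟩

/-- The uniform probability measure `μ_{x₀}` on the boundary: the first letter is uniformly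
distributed among the `2r` letters, and each next one is uniformly distributed among the `2r - 1`
letters that are not the inverse of its predecessor. It is the probability measure with
`μ(B_u) = 1 / (2r (2r - 1)^(|u| - 1))` for `u ≠ e`. -/
def boundaryMeasure (r : ℕ) : Measure (Boundary r) :=
  ∑ s : Fin r × Bool, (2 * r : ℝ≥0∞)⁻¹ • Measure.map (pickWord s) (Measure.infinitePi fun _ : ℕ =>
    (PMF.uniformOfFintype {a : Fin r × Bool // a ≠ invLetter s}).toMeasure)

/-- The set of all infinite words that coincide with `η` on the first `n` letters. -/
def cyl (η : Boundary r) (n : ℕ) : Set (Boundary r) := {ξ | ∀ i < n, ξ.1 i = η.1 i}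

theorem measurable_coord (n : ℕ) : Measurable fun ξ : Boundary r => ξ.1 n :=
  (measurable_pi_apply n).comp measurable_subtype_coe

theorem continuous_coord (n : ℕ) : Continuous fun ξ : Boundary r => ξ.1 n :=
  (continuous_apply n).comp continuous_subtype_val

theorem isOpen_cyl (η : Boundary r) (n : ℕ) : IsOpen (cyl η n) := by
  have : cyl η n = ⋂ i ∈ Finset.range n, (fun ξ : Boundary r => ξ.1 i) ⁻¹' {η.1 i} := by
    ext ξ; simp [cyl]
  rw [this]
  exact isOpen_biInter_finset fun i _ => (isOpen_discrete _).preimage (continuous_coord i)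

theorem measurableSet_cyl (η : Boundary r) (n : ℕ) : MeasurableSet (cyl η n) :=
  (isOpen_cyl η n).measurableSet

theorem measurable_pickSeq (s : Fin r × Bool) (n : ℕ) : Measurable fun k => pickSeq s k n := by
  induction n with
  | zero => exact measurable_const
  | succ n ih =>
    have h := ih.prodMk (measurable_pi_apply (X := fun _ => {a : Fin r × Bool // a ≠ invLetter s}) n)
    exact (Measurable.of_discrete (f := fun p : (Fin r × Bool) × {a : Fin r × Bool //
      a ≠ invLetter s} => Equiv.swap (invLetter s) (invLetter p.1) p.2)).comp h

theorem measurable_pickWord (s : Fin r × Bool) : Measurable (pickWord s) :=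
  (measurable_pi_lambda _ fun n => measurable_pickSeq s n).subtype_mk

instance : IsFiniteMeasure (boundaryMeasure r) := by
  constructor
  rw [boundaryMeasure, Measure.finsetSum_apply]
  refine ENNReal.sum_lt_top.2 fun s _ => ?_
  rw [Measure.smul_apply, smul_eq_mul]
  have hr : 0 < r := Fin.pos s.1
  have : (2 * r : ℝ≥0∞)⁻¹ < ⊤ := ENNReal.inv_lt_top.2 (by positivity)
  exact ENNReal.mul_lt_top this (by
    rw [Measure.map_apply (measurable_pickWord s) .univ]
    exact measure_lt_top _ _)

theorem card_ne (a : Fin r × Bool) : Fintype.card {b : Fin r × Bool // b ≠ a} = 2 * r - 1 := by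
  rw [Fintype.card_subtype_compl]
  simp [mul_comm]

theorem pickWord_preimage (η : Boundary r) (n : ℕ) :
    pickWord (η.1 0) ⁻¹' cyl η (n + 1) = Set.pi (Finset.range n : Set ℕ) fun i =>
      {⟨Equiv.swap (invLetter (η.1 0)) (invLetter (η.1 i)) (η.1 (i + 1)), fun h =>
        η.ne_inv i ((Equiv.swap _ _).injective (h.trans (Equiv.swap_apply_right _ _).symm))⟩} := by
  ext k
  simp only [Set.mem_preimage, cyl, Set.mem_ofPred_eq, Set.mem_pi, Finset.coe_range, Set.mem_Iio,
    Set.mem_singleton_iff]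
  constructor
  · intro h i hi
    have h1 : pickSeq (η.1 0) k i = η.1 i := h i (by omega)
    have h2 : pickSeq (η.1 0) k (i + 1) = η.1 (i + 1) := h (i + 1) (by omega)
    apply Subtype.ext
    rw [pickSeq, h1] at h2
    change (k i : Fin r × Bool) = Equiv.swap (invLetter (η.1 0)) (invLetter (η.1 i)) (η.1 (i + 1))
    rw [← h2, Equiv.swap_apply_self]
  · intro h i
    change i < n + 1 → pickSeq (η.1 0) k i = η.1 i
    induction i with
    | zero => intro _; rfl
    | succ i ih =>
      intro hi
      rw [pickSeq, ih (by omega), h i (by omega)]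
      exact Equiv.swap_apply_self _ _ _

/-- The measure of a cylinder. -/
theorem boundaryMeasure_cyl (η : Boundary r) (n : ℕ) :
    boundaryMeasure r (cyl η (n + 1)) = (2 * r : ℝ≥0∞)⁻¹ * ((2 * r - 1 : ℕ) : ℝ≥0∞)⁻¹ ^ n := by
  rw [boundaryMeasure, Measure.finsetSum_apply, Finset.sum_eq_single (η.1 0)]
  · rw [Measure.smul_apply, smul_eq_mul, Measure.map_apply (measurable_pickWord _)
      (measurableSet_cyl η _), pickWord_preimage, Measure.infinitePi_pi]
    · congr 1
      rw [Finset.prod_congr rfl (g := fun _ => ((2 * r - 1 : ℕ) : ℝ≥0∞)⁻¹)]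
      · simp
      · intro i _
        rw [PMF.toMeasure_apply_singleton _ _ (measurableSet_singleton _),
          PMF.uniformOfFintype_apply, card_ne]
    · intro i _
      exact measurableSet_singleton _
  · intro s _ hs
    rw [Measure.smul_apply, Measure.map_apply (measurable_pickWord _) (measurableSet_cyl η _)]
    have : pickWord s ⁻¹' cyl η (n + 1) = ∅ := by
      ext k
      simp only [Set.mem_preimage, cyl, Set.mem_ofPred_eq, Set.mem_empty_iff_false, iff_false]
      intro h
      exact hs (h 0 (by omega))
    rw [this]; simp
  · simp

/-! ### Quasi-invariance -/

theorem cyl_basis : TopologicalSpace.IsTopologicalBasis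
    {s : Set (Boundary r) | ∃ (η : Boundary r) (n : ℕ), s = cyl η (n + 2)} := by
  apply TopologicalSpace.isTopologicalBasis_of_isOpen_of_nhds
  · rintro _ ⟨η, n, rfl⟩
    exact isOpen_cyl η _
  · intro ξ U hξ hU
    obtain ⟨V, hV, rfl⟩ := isOpen_induced_iff.1 hU
    obtain ⟨I, u, hu, hI⟩ := isOpen_pi_iff.1 hV ξ.1 hξ
    refine ⟨_, ⟨ξ, I.sup id, rfl⟩, fun i _ => rfl, ?_⟩
    intro ζ hζ
    apply hI
    intro i hi
    have : i ≤ I.sup id := Finset.le_sup (f := id) hi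
    have h2 : ζ.1 i = ξ.1 i := hζ i (by omega)
    rw [h2]
    exact (hu i hi).2

theorem cyl_inter {η ζ ξ : Boundary r} {n m : ℕ} (h1 : ξ ∈ cyl η n) (h2 : ξ ∈ cyl ζ m) :
    cyl η n ∩ cyl ζ m = cyl ξ (max n m) := by
  ext x
  simp only [cyl, Set.mem_inter_iff, Set.mem_ofPred_eq] at *
  constructor
  · rintro ⟨ha, hb⟩ i hi
    rcases lt_max_iff.1 hi with hi | hi
    · rw [ha i hi, h1 i hi]
    · rw [hb i hi, h2 i hi]
  · intro h
    exact ⟨fun i hi => by rw [h i (lt_max_of_lt_left hi), h1 i hi],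
      fun i hi => by rw [h i (lt_max_of_lt_right hi), h2 i hi]⟩

theorem measure_ext_cyl {μ ν : Measure (Boundary r)} [IsFiniteMeasure μ]
    (h : ∀ η n, μ (cyl η (n + 2)) = ν (cyl η (n + 2))) : μ = ν := by
  refine Measure.ext_of_generateFrom_of_cover_subset
    (S := {s : Set (Boundary r) | ∃ (η : Boundary r) (n : ℕ), s = cyl η (n + 2)})
    (T := {s : Set (Boundary r) | ∃ (η : Boundary r), s = cyl η 2}) ?_ ?_ ?_ ?_ ?_ ?_ ?_
  · rw [← cyl_basis.borel_eq_generateFrom]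
    exact BorelSpace.measurable_eq
  · rintro _ ⟨η, n, rfl⟩ _ ⟨ζ, m, rfl⟩ ⟨ξ, h1, h2⟩
    exact ⟨ξ, max n m, by rw [cyl_inter h1 h2]; congr 1; omega⟩
  · rintro _ ⟨η, rfl⟩
    exact ⟨η, 0, rfl⟩
  · refine (Set.countable_range fun p : (Fin r × Bool) × (Fin r × Bool) =>
      {ξ : Boundary r | ξ.1 0 = p.1 ∧ ξ.1 1 = p.2}).mono ?_
    rintro _ ⟨η, rfl⟩
    refine ⟨(η.1 0, η.1 1), ?_⟩
    ext ξ
    simp only [cyl, Set.mem_ofPred_eq]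
    constructor
    · rintro ⟨h0, h1⟩ i hi
      interval_cases i <;> assumption
    · intro h
      exact ⟨h 0 (by omega), h 1 (by omega)⟩
  · exact Set.eq_univ_of_forall fun ξ => ⟨_, ⟨ξ, rfl⟩, fun i _ => rfl⟩
  · intro s _
    exact measure_ne_top _ _
  · rintro _ ⟨η, n, rfl⟩
    exact h η n

theorem letterMul_mem_cyl_of_eq {a : Fin r × Bool} {η : Boundary r} (h : η.1 0 = a) (n : ℕ) :
    Boundary.letterMul a ⁻¹' cyl η (n + 2) = cyl η.tail (n + 1) := by
  subst h
  ext ξ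
  simp only [Set.mem_preimage, cyl, Set.mem_ofPred_eq]
  by_cases h0 : ξ.1 0 = invLetter (η.1 0)
  · rw [Boundary.letterMul_of_eq h0]
    constructor
    · intro h
      exact absurd ((h 0 (by omega)).trans (by rw [h0, invLetter_invLetter])) (ξ.ne_inv 0)
    · intro h
      exact absurd ((h 0 (by omega)).symm.trans h0) (η.ne_inv 0)
  · rw [Boundary.letterMul_of_ne h0]
    constructor
    · intro h i hi
      exact h (i + 1) (by omega)
    · intro h i hi
      cases i with
      | zero => rfl
      | succ i => exact h i (by omega)

theorem letterMul_mem_cyl_of_ne {a : Fin r × Bool} {η : Boundary r}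
    (h : η.1 0 ≠ invLetter (invLetter a)) (n : ℕ) :
    Boundary.letterMul a ⁻¹' cyl η (n + 1) = cyl (η.cons (invLetter a) h) (n + 2) := by
  ext ξ
  simp only [Set.mem_preimage, cyl, Set.mem_ofPred_eq]
  by_cases h0 : ξ.1 0 = invLetter a
  · rw [Boundary.letterMul_of_eq h0]
    constructor
    · intro h i hi
      cases i with
      | zero => exact h0
      | succ i => exact h i (by omega)
    · intro h i hi
      exact h (i + 1) (by omega)
  · rw [Boundary.letterMul_of_ne h0]
    constructor
    · intro h1
      exact absurd (h1 0 (by omega)).symm (by rwa [invLetter_invLetter] at h)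
    · intro h
      exact absurd (h 0 (by omega)) h0

theorem measurable_letterMul (a : Fin r × Bool) : Measurable (Boundary.letterMul a) := by
  have : ∀ n, Measurable fun ξ : Boundary r => (ξ.letterMul a).1 n := by
    intro n
    have e : (fun ξ : Boundary r => (ξ.letterMul a).1 n) = fun ξ =>
        if ξ.1 0 = invLetter a then ξ.1 (n + 1) else Nat.casesOn n a ξ.1 := by
      funext ξ
      split_ifs with h
      · rw [Boundary.letterMul_of_eq h]; rfl
      · rw [Boundary.letterMul_of_ne h]; rfl
    rw [e]
    refine Measurable.ite (measurable_coord 0 (measurableSet_singleton _)) (measurable_coord _) ?_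
    cases n with
    | zero => exact measurable_const
    | succ n => exact measurable_coord n
  exact (measurable_pi_lambda _ this).subtype_mk

theorem measurable_action (γ : FreeGroup (Fin r)) : Measurable fun ξ : Boundary r => γ • ξ := by
  rw [← FreeGroup.mk_toWord (x := γ)]
  generalize γ.toWord = L
  induction L with
  | nil =>
    rw [← FreeGroup.one_eq_mk]
    simp only [one_smul]
    exact measurable_id
  | cons a L ih =>
    simp only [mk_cons a L, mul_smul, letter_smul]
    exact (measurable_letterMul a).comp ih

theorem measurable_letterBusemann (a : Fin r × Bool) : Measurable (letterBusemann a) :=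
  Measurable.ite (measurable_coord 0 (measurableSet_singleton _)) measurable_const measurable_const

theorem measurable_busemann (γ : FreeGroup (Fin r)) :
    Measurable fun ξ : Boundary r => busemann ξ (basePoint r) (γ • basePoint r) := by
  rw [← FreeGroup.mk_toWord (x := γ)]
  generalize γ.toWord = L
  induction L with
  | nil =>
    simp only [← FreeGroup.one_eq_mk, busemann_one]
    exact measurable_const
  | cons a L ih =>
    simp only [mk_cons a L, busemann_mul]
    exact (measurable_letterBusemann a).add (ih.comp (measurable_letterMul _))

theorem measurable_poisson (γ : FreeGroup (Fin r)) : Measurable (poisson γ) :=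
  measurable_const.pow (measurable_busemann γ)

theorem base_pos (ξ : Boundary r) : (0 : ℝ) < 2 * (r : ℝ) - 1 := by
  have : (1 : ℝ) ≤ r := by exact_mod_cast Fin.pos (ξ.1 0).1
  linarith

theorem poisson_pos (γ : FreeGroup (Fin r)) (ξ : Boundary r) : 0 < poisson γ ξ :=
  Real.rpow_pos_of_pos (base_pos ξ) _

theorem poisson_mul (γ γ' : FreeGroup (Fin r)) (ξ : Boundary r) :
    poisson (γ * γ') ξ = poisson γ ξ * poisson γ' (γ⁻¹ • ξ) := by
  rw [poisson, busemann_cocycle, Real.rpow_add (base_pos ξ)]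
  rfl

theorem poisson_one (ξ : Boundary r) : poisson 1 ξ = 1 := by
  rw [poisson, busemann_one, Real.rpow_zero]

theorem poisson_letter (a : Fin r × Bool) (ξ : Boundary r) :
    poisson (FreeGroup.mk [a]) ξ =
      if ξ.1 0 = a then 2 * (r : ℝ) - 1 else (2 * (r : ℝ) - 1)⁻¹ := by
  have := busemann_mul a 1 ξ
  rw [mul_one, busemann_one, add_zero] at this
  rw [poisson, this, letterBusemann]
  split_ifs
  · rw [Real.rpow_one]
  · rw [Real.rpow_neg_one]

theorem map_letter (a : Fin r × Bool) :
    (boundaryMeasure r).map (Boundary.letterMul a) =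
      (boundaryMeasure r).withDensity fun ξ => ENNReal.ofReal (poisson (FreeGroup.mk [a]) ξ) := by
  have : IsFiniteMeasure ((boundaryMeasure r).map (Boundary.letterMul a)) :=
    Measure.isFiniteMeasure_map _ _
  apply measure_ext_cyl
  intro η n
  have hr : 1 ≤ r := Fin.pos a.1
  have hb : ENNReal.ofReal (2 * (r : ℝ) - 1) = ((2 * r - 1 : ℕ) : ℝ≥0∞) := by
    rw [← ENNReal.ofReal_natCast, Nat.cast_sub (by omega)]
    simp
  have hb0 : ((2 * r - 1 : ℕ) : ℝ≥0∞) ≠ 0 := by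
    rw [Nat.cast_ne_zero]; omega
  have hbt : ((2 * r - 1 : ℕ) : ℝ≥0∞) ≠ ⊤ := ENNReal.natCast_ne_top _
  rw [Measure.map_apply (measurable_letterMul a) (measurableSet_cyl η _),
    withDensity_apply _ (measurableSet_cyl η _)]
  by_cases h : η.1 0 = a
  · rw [letterMul_mem_cyl_of_eq h, boundaryMeasure_cyl,
      setLIntegral_congr_fun (g := fun _ => ((2 * r - 1 : ℕ) : ℝ≥0∞)) (measurableSet_cyl η _),
      setLIntegral_const, boundaryMeasure_cyl, pow_succ]
    · generalize hx : ((2 * r - 1 : ℕ) : ℝ≥0∞) = x at *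
      calc (2 * r : ℝ≥0∞)⁻¹ * x⁻¹ ^ n = (2 * r : ℝ≥0∞)⁻¹ * x⁻¹ ^ n * (x⁻¹ * x) := by
            rw [ENNReal.inv_mul_cancel hb0 hbt, mul_one]
        _ = x * ((2 * r : ℝ≥0∞)⁻¹ * (x⁻¹ ^ n * x⁻¹)) := by ring
    intro ξ hξ
    have : ξ.1 0 = a := (hξ 0 (by omega)).trans h
    simp only [poisson_letter, if_pos this, hb]
  · have h' : η.1 0 ≠ invLetter (invLetter a) := by simpa using h
    rw [letterMul_mem_cyl_of_ne h', boundaryMeasure_cyl,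
      setLIntegral_congr_fun (g := fun _ => ((2 * r - 1 : ℕ) : ℝ≥0∞)⁻¹) (measurableSet_cyl η _),
      setLIntegral_const, boundaryMeasure_cyl, pow_succ, pow_succ]
    · ring
    intro ξ hξ
    have : ξ.1 0 ≠ a := fun hc => h ((hξ 0 (by omega)).symm.trans hc)
    simp only [poisson_letter, if_neg this]
    rw [ENNReal.ofReal_inv_of_pos (base_pos ξ), hb]

/-- The Radon–Nikodym derivative of `γ_* μ` with respect to `μ` is `P(γ, ·)`. -/
theorem map_action (γ : FreeGroup (Fin r)) :
    (boundaryMeasure r).map (fun ξ => γ • ξ) =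
      (boundaryMeasure r).withDensity fun ξ => ENNReal.ofReal (poisson γ ξ) := by
  rw [← FreeGroup.mk_toWord (x := γ)]
  generalize γ.toWord = L
  induction L with
  | nil =>
    simp only [← FreeGroup.one_eq_mk, poisson_one, one_smul, ENNReal.ofReal_one]
    rw [Measure.map_id', withDensity_const, one_smul]
  | cons a L ih =>
    have e : (fun ξ : Boundary r => FreeGroup.mk (a :: L) • ξ) =
        Boundary.letterMul a ∘ fun ξ => FreeGroup.mk L • ξ := by
      funext ξ
      rw [mk_cons, mul_smul, letter_smul]; rfl
    rw [e, ← Measure.map_map (measurable_letterMul a) (measurable_action _), ih]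
    ext s hs
    rw [Measure.map_apply (measurable_letterMul a) hs,
      withDensity_apply _ (measurable_letterMul a hs), withDensity_apply _ hs]
    have hm : ∀ γ : FreeGroup (Fin r),
        Measurable fun ξ : Boundary r => ENNReal.ofReal (poisson γ ξ) :=
      fun γ => (measurable_poisson γ).ennreal_ofReal
    have hm' : Measurable fun ξ : Boundary r =>
        ENNReal.ofReal (poisson (FreeGroup.mk L) (ξ.letterMul (invLetter a))) :=
      (hm _).comp (measurable_letterMul _)
    calc ∫⁻ ξ in Boundary.letterMul a ⁻¹' s, ENNReal.ofReal (poisson (FreeGroup.mk L) ξ)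
          ∂boundaryMeasure r
        = ∫⁻ ξ in Boundary.letterMul a ⁻¹' s, ENNReal.ofReal (poisson (FreeGroup.mk L)
            ((ξ.letterMul a).letterMul (invLetter a))) ∂boundaryMeasure r := by
          simp only [Boundary.letterMul_letterMul]
      _ = ∫⁻ ξ in s, ENNReal.ofReal (poisson (FreeGroup.mk L) (ξ.letterMul (invLetter a)))
            ∂(boundaryMeasure r).map (Boundary.letterMul a) := by
          rw [setLIntegral_map hs hm' (measurable_letterMul a)]
      _ = ∫⁻ ξ in s, ENNReal.ofReal (poisson (FreeGroup.mk (a :: L)) ξ) ∂boundaryMeasure r := by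
          rw [map_letter, setLIntegral_withDensity_eq_setLIntegral_mul _ (hm _) hm' hs]
          refine setLIntegral_congr_fun hs fun ξ _ => ?_
          rw [mk_cons a L, poisson_mul, inv_letter, letter_smul,
            ENNReal.ofReal_mul (poisson_pos _ _).le]
          rfl

/-! ### The quasi-regular representation -/

/-- `L²(B, μ_{x₀})`. -/
abbrev L2 (r : ℕ) : Type := Lp ℂ 2 (boundaryMeasure r)

/-- `ξ ↦ P(γ, ξ)^{1/2} g(γ⁻¹ ξ)`. -/
def quasiRegularFun (γ : FreeGroup (Fin r)) (g : Boundary r → ℂ) (ξ : Boundary r) : ℂ :=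
  ((poisson γ ξ ^ (1 / 2 : ℝ) : ℝ) : ℂ) * g (γ⁻¹ • ξ)

theorem quasiMeasurePreserving_action (γ : FreeGroup (Fin r)) :
    Measure.QuasiMeasurePreserving (fun ξ : Boundary r => γ • ξ)
      (boundaryMeasure r) (boundaryMeasure r) := by
  refine ⟨measurable_action γ, ?_⟩
  rw [map_action]
  exact withDensity_absolutelyContinuous _ _

theorem quasiRegularFun_congr (γ : FreeGroup (Fin r)) {g h : Boundary r → ℂ}
    (e : g =ᵐ[boundaryMeasure r] h) :
    quasiRegularFun γ g =ᵐ[boundaryMeasure r] quasiRegularFun γ h := by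
  filter_upwards [(quasiMeasurePreserving_action γ⁻¹).ae e] with ξ hξ
  rw [quasiRegularFun, quasiRegularFun, hξ]

theorem eLpNorm_quasiRegularFun (γ : FreeGroup (Fin r)) {g : Boundary r → ℂ}
    (hg : AEStronglyMeasurable g (boundaryMeasure r)) :
    eLpNorm (quasiRegularFun γ g) 2 (boundaryMeasure r) = eLpNorm g 2 (boundaryMeasure r) := by
  wlog hs : StronglyMeasurable g generalizing g
  · rw [eLpNorm_congr_ae hg.ae_eq_mk, eLpNorm_congr_ae (quasiRegularFun_congr γ hg.ae_eq_mk)]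
    exact this hg.stronglyMeasurable_mk.aestronglyMeasurable hg.stronglyMeasurable_mk
  rw [eLpNorm_eq_lintegral_rpow_enorm_toReal (by simp) (by simp),
    eLpNorm_eq_lintegral_rpow_enorm_toReal (by simp) (by simp)]
  congr 1
  have hm : Measurable fun ξ => ‖g ξ‖ₑ ^ (2 : ℝ≥0∞).toReal := hs.measurable.enorm.pow_const _
  have hm' : Measurable fun ξ => ‖g (γ⁻¹ • ξ)‖ₑ ^ (2 : ℝ≥0∞).toReal :=
    hm.comp (measurable_action γ⁻¹)
  calc ∫⁻ ξ, ‖quasiRegularFun γ g ξ‖ₑ ^ (2 : ℝ≥0∞).toReal ∂boundaryMeasure r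
      = ∫⁻ ξ, ENNReal.ofReal (poisson γ ξ) * ‖g (γ⁻¹ • ξ)‖ₑ ^ (2 : ℝ≥0∞).toReal
          ∂boundaryMeasure r := by
        congr 1
        funext ξ
        have hp := (poisson_pos γ ξ).le
        rw [quasiRegularFun, enorm_mul, ENNReal.mul_rpow_of_nonneg _ _ (by simp)]
        congr 1
        rw [← ofReal_norm, Complex.norm_real, Real.norm_of_nonneg (by positivity),
          ENNReal.ofReal_rpow_of_nonneg (by positivity) (by simp), ← Real.rpow_mul hp]
        simp
    _ = ∫⁻ ξ, ‖g (γ⁻¹ • ξ)‖ₑ ^ (2 : ℝ≥0∞).toReal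
          ∂(boundaryMeasure r).map (fun ξ => γ • ξ) := by
        rw [map_action,
          lintegral_withDensity_eq_lintegral_mul _ (measurable_poisson γ).ennreal_ofReal hm']
        rfl
    _ = ∫⁻ ξ, ‖g ξ‖ₑ ^ (2 : ℝ≥0∞).toReal ∂boundaryMeasure r := by
        rw [lintegral_map hm' (measurable_action γ)]
        simp only [inv_smul_smul]

theorem memLp_quasiRegularFun (γ : FreeGroup (Fin r)) (g : L2 r) :
    MemLp (quasiRegularFun γ g) 2 (boundaryMeasure r) := by
  refine ⟨?_, ?_⟩
  · have h1 : Measurable fun ξ => ((poisson γ ξ ^ (1 / 2 : ℝ) : ℝ) : ℂ) :=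
      Complex.measurable_ofReal.comp ((measurable_poisson γ).pow_const _)
    exact h1.aestronglyMeasurable.mul
      ((Lp.aestronglyMeasurable g).comp_quasiMeasurePreserving (quasiMeasurePreserving_action γ⁻¹))
  · rw [eLpNorm_quasiRegularFun γ (Lp.aestronglyMeasurable g)]
    exact Lp.eLpNorm_lt_top g

/-- The operator `π(γ)` as an isometry of `L²(B)`. -/
def quasiRegularIsometry (γ : FreeGroup (Fin r)) : L2 r →ₗᵢ[ℂ] L2 r where
  toFun g := (memLp_quasiRegularFun γ g).toLp
  map_add' g h := by
    apply Lp.ext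
    filter_upwards [(memLp_quasiRegularFun γ (g + h)).coeFn_toLp,
      (memLp_quasiRegularFun γ g).coeFn_toLp, (memLp_quasiRegularFun γ h).coeFn_toLp,
      Lp.coeFn_add (memLp_quasiRegularFun γ g).toLp (memLp_quasiRegularFun γ h).toLp,
      quasiRegularFun_congr γ (Lp.coeFn_add g h)] with ξ h1 h2 h3 h4 h5
    rw [h1, h4, h5, Pi.add_apply, h2, h3]
    simp only [quasiRegularFun, Pi.add_apply, mul_add]
  map_smul' c g := by
    apply Lp.ext
    filter_upwards [(memLp_quasiRegularFun γ (c • g)).coeFn_toLp,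
      (memLp_quasiRegularFun γ g).coeFn_toLp,
      Lp.coeFn_smul c (memLp_quasiRegularFun γ g).toLp,
      quasiRegularFun_congr γ (Lp.coeFn_smul c g)] with ξ h1 h2 h3 h4
    rw [h1, RingHom.id_apply, h3, h4, Pi.smul_apply, h2]
    simp only [quasiRegularFun, Pi.smul_apply, smul_eq_mul]
    ring
  norm_map' g := by
    change ‖(memLp_quasiRegularFun γ g).toLp‖ = ‖g‖
    rw [Lp.norm_toLp, eLpNorm_quasiRegularFun γ (Lp.aestronglyMeasurable g)]
    rfl

theorem quasiRegularIsometry_coeFn (γ : FreeGroup (Fin r)) (g : L2 r) :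
    quasiRegularIsometry γ g =ᵐ[boundaryMeasure r] quasiRegularFun γ g :=
  (memLp_quasiRegularFun γ g).coeFn_toLp

theorem quasiRegularIsometry_mul (γ γ' : FreeGroup (Fin r)) (g : L2 r) :
    quasiRegularIsometry (γ * γ') g = quasiRegularIsometry γ (quasiRegularIsometry γ' g) := by
  apply Lp.ext
  filter_upwards [quasiRegularIsometry_coeFn (γ * γ') g,
    quasiRegularIsometry_coeFn γ (quasiRegularIsometry γ' g),
    quasiRegularFun_congr γ (quasiRegularIsometry_coeFn γ' g)] with ξ h1 h2 h3
  rw [h1, h2, h3]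
  simp only [quasiRegularFun]
  rw [poisson_mul, Real.mul_rpow (poisson_pos _ _).le (poisson_pos _ _).le, Complex.ofReal_mul,
    mul_inv_rev, mul_smul, mul_assoc]

theorem quasiRegularIsometry_one (g : L2 r) : quasiRegularIsometry 1 g = g := by
  apply Lp.ext
  filter_upwards [quasiRegularIsometry_coeFn 1 g] with ξ h1
  rw [h1, quasiRegularFun, poisson_one, inv_one, one_smul, Real.one_rpow, Complex.ofReal_one,
    one_mul]

/-- The quasi-regular representation `π` of the free group on `L²(B)`,
`(π(γ) g)(ξ) = P(γ, ξ)^{1/2} g(γ⁻¹ ξ)`. It is a unitary representation. -/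
def quasiRegular (r : ℕ) : FreeGroup (Fin r) →* (L2 r ≃ₗᵢ[ℂ] L2 r) where
  toFun γ :=
    { toLinearEquiv := LinearEquiv.ofLinearMap (quasiRegularIsometry γ).toLinearMap
        (quasiRegularIsometry γ⁻¹).toLinearMap
        (LinearMap.ext fun g => by
          change quasiRegularIsometry γ (quasiRegularIsometry γ⁻¹ g) = g
          rw [← quasiRegularIsometry_mul, mul_inv_cancel, quasiRegularIsometry_one])
        (LinearMap.ext fun g => by
          change quasiRegularIsometry γ⁻¹ (quasiRegularIsometry γ g) = g
          rw [← quasiRegularIsometry_mul, inv_mul_cancel, quasiRegularIsometry_one])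
      norm_map' := (quasiRegularIsometry γ).norm_map }
  map_one' := LinearIsometryEquiv.ext quasiRegularIsometry_one
  map_mul' γ γ' := LinearIsometryEquiv.ext (quasiRegularIsometry_mul γ γ')

theorem quasiRegular_coeFn (γ : FreeGroup (Fin r)) (g : L2 r) :
    quasiRegular r γ g =ᵐ[boundaryMeasure r] quasiRegularFun γ g :=
  quasiRegularIsometry_coeFn γ g

/-- The Harish-Chandra function `Ξ(γ) = ⟨π(γ) 1_B, 1_B⟩ = ∫ P(γ, ξ)^{1/2} dμ(ξ)`. -/
def harishChandra (γ : FreeGroup (Fin r)) : ℝ :=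
  ∫ ξ, poisson γ ξ ^ (1 / 2 : ℝ) ∂boundaryMeasure r

/-! ### The operators -/

theorem finite_sphere (r n : ℕ) : {γ : FreeGroup (Fin r) | γ.norm = n}.Finite :=
  Set.Finite.of_finite_image ((List.finite_length_eq (Fin r × Bool) n).subset (by
    rintro _ ⟨γ, hγ, rfl⟩; exact hγ)) FreeGroup.toWord_injective.injOn

/-- The sphere `S_n` of the elements of length `n`. -/
def sphere (r n : ℕ) : Finset (FreeGroup (Fin r)) := (finite_sphere r n).toFinset

/-- The value `f(γ x₀)` of a function on `X̄`. -/
def orbitValue (f : C(Compactification r, ℂ)) (γ : FreeGroup (Fin r)) : ℂ :=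
  f (Compactification.ofTree (γ • basePoint r))

/-- `M_n(f) = 1/|S_n| ∑_{γ ∈ S_n} f(γ x₀) π(γ) / Ξ(γ)`. -/
def average (f : C(Compactification r, ℂ)) (n : ℕ) : L2 r →L[ℂ] L2 r :=
  ((sphere r n).card : ℂ)⁻¹ • ∑ γ ∈ sphere r n,
    (orbitValue f γ / (harishChandra γ : ℂ)) •
      ((quasiRegular r γ).toContinuousLinearEquiv : L2 r →L[ℂ] L2 r)

theorem continuous_ofBoundary :
    Continuous (Compactification.ofBoundary : Boundary r → Compactification r) := by
  refine ⟨fun U hU => isOpen_iff_forall_mem_open.2 fun ξ hξ => ?_⟩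
  obtain ⟨_, ⟨n, rfl⟩, hn⟩ := hU.2 ξ hξ
  refine ⟨cyl ξ n, fun ζ hζ => hn (Or.inr ⟨ζ, ⟨n, ?_⟩, rfl⟩), isOpen_cyl ξ n, fun i _ => rfl⟩
  rw [Boundary.pre, Boundary.pre]
  congr 2
  funext i
  exact (hζ i i.2).symm

/-- The restriction of a continuous function on `X̄` to the boundary. -/
def restrictBoundary (f : C(Compactification r, ℂ)) : C(Boundary r, ℂ) :=
  f.comp ⟨Compactification.ofBoundary, continuous_ofBoundary⟩

/-- The multiplication operator `m(φ)` on `L²(B)`. -/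
def mulOperator (φ : C(Boundary r, ℂ)) : L2 r →L[ℂ] L2 r :=
  (ContinuousLinearMap.mul ℂ ℂ).holderL (boundaryMeasure r) ∞ 2 2
    (ContinuousMap.toLp ∞ (boundaryMeasure r) ℂ φ)

/-- The orthogonal projection of `L²(B)` onto the constant functions. -/
def constProjection (r : ℕ) : L2 r →L[ℂ] L2 r :=
  (Submodule.span ℂ {(Lp.const 2 (boundaryMeasure r) (1 : ℂ) : L2 r)}).starProjection

/-- `M(f) = m(f|_B) P_1`. -/
def limitOperator (f : C(Compactification r, ℂ)) : L2 r →L[ℂ] L2 r :=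
  mulOperator (restrictBoundary f) ∘L constProjection r

end FreeBoundary

end

open Filter Topology FreeBoundary

/-!
Write `q = 2r - 1`, `μ` for the boundary measure, and `ξ.pre n` for the prefix `ξ₁ ⋯ ξₙ`. The map
`ξ ↦ ξ.pre n` pushes `μ` forward to the uniform measure on the sphere `Sₙ` (`average_sphere`), so
every average over `Sₙ` is an integral over the boundary.

**The kernel.** If `K` is the length of the common prefix of `η` and `ξ`, capped at `n`, then
`P(η.pre n, ξ)^{1/2} = q^(-n/2) q^K`, and `∫ q^K dμ = 1 + n (r - 1) / r` whichever of the two words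
is integrated out. Hence `ρ(γ, ξ) = P(γ, ξ)^{1/2} / Ξ(γ)` is a probability density in `ξ`, and its
average over `γ ∈ Sₙ` is the constant `1` (`average_rootDensity`). Moreover `ρ(γ, ·) μ` concentrates
near `γ` as `n = |γ| → ∞`, since `ρ(γ, ξ)` is at most `q^k / (1 + n (r - 1) / r)` as soon as `ξ` and
`γ` differ in the first `k` letters (`rootDensity_le_of_notMem`), and its translate by `γ⁻¹` is
`ρ(γ⁻¹, ·) μ` (`integral_rootDensity_smul`).

**Boundedness.** By the arithmetic-geometric mean inequality, the translation formula and the fact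
that `ρ` averages to `1`, `|⟨Mₙ(f) g, h⟩| ≤ C (‖g‖² + ‖h‖²) / 2` where `C` bounds `|f|` on `Sₙ x₀`.
By compactness `C` can be chosen independently of `n` for large `n`; therefore `‖Mₙ(f)‖` is
eventually bounded (`exists_norm_average_le`), and it suffices to prove weak convergence for `g` and
`h` that depend on finitely many letters only (`tendsto_inner_of_dense`).

**Convergence.** For such `g` and `h`, concentration replaces `⟨π(γ) g, h⟩ / Ξ(γ)` by the product of
`g` evaluated near `γ⁻¹` and of `h̄` evaluated near `γ` (`norm_matrixCoeff_sub_le`). By compactness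
`f(ξ.pre n x₀)` converges to `f(ξ)` uniformly in `ξ`. What is left is
`∫ f(ξ) h̄(ξ) B(σⁿ⁻ᵏ ξ) dμ(ξ)`, where `σ` is the shift and `B` is `g` read along the inverse of a
prefix of length `k`. The shift is mixing (`tendsto_integral_mul_comp_shift`) because the
transition matrix of the letters is `(J - I) / q`, with `J` the matrix of ones and `I` the
permutation matrix of `s ↦ s⁻¹`: each step divides the discrepancy from equidistribution by `-q`.
So the limit is `∫ f h̄ dμ · ∫ g dμ = ⟨M(f) g, h⟩`.
-/

noncomputable section

namespace FreeBoundary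

open MeasureTheory Filter Topology
open scoped ENNReal

variable {r : ℕ}

/-! ### Infinite words: prefixes, shifts and reversals -/

theorem Boundary.ext {ξ ζ : Boundary r} (h : ∀ i, ξ.1 i = ζ.1 i) : ξ = ζ :=
  Subtype.ext (funext h)

/-- The infinite word `s s s ⋯`. -/
def constWord (s : Fin r × Bool) : Boundary r := ⟨fun _ => s, fun _ _ => rfl⟩

/-- Delete the first `m` letters. -/
def Boundary.shift (m : ℕ) (ξ : Boundary r) : Boundary r :=
  ⟨fun i => ξ.1 (i + m), fun i => by
    have := ξ.2 (i + m)
    rwa [show i + m + 1 = i + 1 + m by omega] at this⟩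

theorem Boundary.shift_succ (m : ℕ) (ξ : Boundary r) : ξ.shift (m + 1) = ξ.tail.shift m :=
  Boundary.ext fun i => congrArg ξ.1 (by omega)

/-- An infinite word whose prefix of length `n` is the inverse of the prefix of length `n` of `ξ`.
The letters from position `n` on repeat the inverse of the first letter of `ξ`, by truncated
subtraction. -/
def Boundary.rev (n : ℕ) (ξ : Boundary r) : Boundary r :=
  ⟨fun i => invLetter (ξ.1 (n - 1 - i)), fun i h => by
    change (ξ.1 (n - 1 - i)).1 = (ξ.1 (n - 1 - (i + 1))).1 at h
    change (!(ξ.1 (n - 1 - i)).2) = !(ξ.1 (n - 1 - (i + 1))).2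
    by_cases hi : i + 1 < n
    · have h2 := ξ.2 (n - 1 - (i + 1))
      rw [show n - 1 - (i + 1) + 1 = n - 1 - i by omega] at h2
      exact congrArg (!·) (h2 h.symm).symm
    · rw [show n - 1 - (i + 1) = n - 1 - i by omega]⟩

theorem Boundary.pre_eq_iff {ξ ζ : Boundary r} {n : ℕ} :
    ξ.pre n = ζ.pre n ↔ ∀ i < n, ξ.1 i = ζ.1 i := by
  rw [← FreeGroup.toWord_inj, toWord_pre, toWord_pre, List.ofFn_inj, funext_iff]
  exact ⟨fun h i hi => h ⟨i, hi⟩, fun h i => h i i.2⟩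

theorem Boundary.inv_pre (n : ℕ) (ξ : Boundary r) : (ξ.pre n)⁻¹ = (ξ.rev n).pre n := by
  rw [← FreeGroup.toWord_inj, FreeGroup.toWord_inv, toWord_pre, toWord_pre, FreeGroup.invRev]
  apply List.ext_getElem
  · simp
  · intro i h1 h2
    simp [rev, invLetter, List.getElem_reverse]

theorem exists_pre_eq (hr : 1 ≤ r) (γ : FreeGroup (Fin r)) :
    ∃ ξ : Boundary r, ξ.pre γ.norm = γ := by
  have key : ∀ L : List (Fin r × Bool), FreeGroup.IsReduced L →
      ∃ ξ : Boundary r, (List.ofFn fun i : Fin L.length => ξ.1 i) = L := by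
    intro L
    induction L with
    | nil => exact fun _ => ⟨constWord (⟨0, hr⟩, true), rfl⟩
    | cons a L ih =>
      intro hL
      cases L with
      | nil => exact ⟨constWord a, rfl⟩
      | cons b L =>
        rw [FreeGroup.IsReduced, List.isChain_cons_cons] at hL
        obtain ⟨ξ, hξ⟩ := ih hL.2
        have h0 : ξ.1 0 = b := by
          rw [List.length_cons, List.ofFn_succ] at hξ
          exact (List.cons.inj hξ).1
        refine ⟨ξ.cons a (by rw [h0]; exact ne_invLetter_iff.2 hL.1), ?_⟩
        rw [List.length_cons, List.ofFn_succ]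
        exact congrArg (a :: ·) hξ
  obtain ⟨ξ, hξ⟩ := key γ.toWord FreeGroup.isReduced_toWord
  exact ⟨ξ, FreeGroup.toWord_injective ((ξ.toWord_pre _).trans hξ)⟩

theorem mem_sphere {n : ℕ} {γ : FreeGroup (Fin r)} : γ ∈ sphere r n ↔ γ.norm = n := by
  simp [sphere]

theorem pre_mem_sphere (ξ : Boundary r) (n : ℕ) : ξ.pre n ∈ sphere r n :=
  mem_sphere.2 (ξ.norm_pre n)

theorem exists_pre_eq_of_mem_sphere (hr : 1 ≤ r) {n : ℕ} {γ : FreeGroup (Fin r)}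
    (h : γ ∈ sphere r n) : ∃ ξ : Boundary r, ξ.pre n = γ := by
  rw [mem_sphere] at h
  subst h
  exact exists_pre_eq hr γ

theorem sum_sphere_inv {E : Type*} [AddCommMonoid E] (n : ℕ) (F : FreeGroup (Fin r) → E) :
    ∑ γ ∈ sphere r n, F γ⁻¹ = ∑ γ ∈ sphere r n, F γ :=
  Finset.sum_nbij' (·⁻¹) (·⁻¹) (fun γ h => by rw [mem_sphere] at *; rwa [FreeGroup.norm_inv_eq])
    (fun γ h => by rw [mem_sphere] at *; rwa [FreeGroup.norm_inv_eq]) (by simp) (by simp) (by simp)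

/-- `g` depends on the first `k` letters only. -/
def DependsOnPrefix {E : Type*} (k : ℕ) (g : Boundary r → E) : Prop :=
  ∀ ξ ζ : Boundary r, (∀ i < k, ξ.1 i = ζ.1 i) → g ξ = g ζ

theorem DependsOnPrefix.mono {E : Type*} {k l : ℕ} {g : Boundary r → E} (h : DependsOnPrefix k g)
    (hkl : k ≤ l) : DependsOnPrefix l g :=
  fun ξ ζ he => h ξ ζ fun i hi => he i (by omega)

theorem DependsOnPrefix.continuous {E : Type*} [TopologicalSpace E] {k : ℕ} {g : Boundary r → E}
    (h : DependsOnPrefix k g) : Continuous g :=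
  continuous_iff_continuousAt.2 fun ξ => continuousAt_const.congr <| by
    filter_upwards [(isOpen_cyl ξ k).mem_nhds fun i _ => rfl] with ζ hζ
    exact h ξ ζ fun i hi => (hζ i hi).symm

theorem continuous_bounded {E : Type*} [SeminormedAddCommGroup E] {g : Boundary r → E}
    (h : Continuous g) : ∃ C : ℝ, 0 ≤ C ∧ ∀ ξ, ‖g ξ‖ ≤ C := by
  obtain ⟨C, hC⟩ := isCompact_univ.exists_bound_of_continuousOn h.continuousOn
  exact ⟨max C 0, le_max_right _ _, fun ξ => (hC ξ trivial).trans (le_max_left _ _)⟩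

theorem continuous_boundary_iff {X : Type*} [TopologicalSpace X] {F : X → Boundary r} :
    Continuous F ↔ ∀ i, Continuous fun x => (F x).1 i :=
  continuous_induced_rng.trans continuous_pi_iff

theorem continuous_shift (m : ℕ) : Continuous (Boundary.shift (r := r) m) :=
  continuous_boundary_iff.2 fun i => continuous_coord (i + m)

theorem continuous_tail : Continuous (Boundary.tail (r := r)) :=
  continuous_boundary_iff.2 fun i => continuous_coord (i + 1)

theorem dependsOnPrefix_comp_pre {E : Type*} (n : ℕ) (F : FreeGroup (Fin r) → E) :
    DependsOnPrefix n fun ξ : Boundary r => F (ξ.pre n) :=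
  fun _ _ h => congrArg F (Boundary.pre_eq_iff.2 h)

theorem DependsOnPrefix.comp_rev {E : Type*} {k : ℕ} {g : Boundary r → E}
    (h : DependsOnPrefix k g) : DependsOnPrefix k fun ξ => g (ξ.rev k) :=
  fun _ _ he => h _ _ fun i hi => congrArg invLetter (he _ (by omega))

theorem DependsOnPrefix.rev_eq {E : Type*} {k n : ℕ} {g : Boundary r → E}
    (h : DependsOnPrefix k g) (hk : k ≤ n) (ξ : Boundary r) :
    g (ξ.rev n) = g ((ξ.shift (n - k)).rev k) :=
  h _ _ fun i hi => congrArg (fun j => invLetter (ξ.1 j)) (by omega)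

/-! ### The boundary measure and averages over spheres -/

theorem isProbabilityMeasure_boundaryMeasure (hr : 1 ≤ r) :
    IsProbabilityMeasure (boundaryMeasure r) := by
  constructor
  rw [boundaryMeasure, Measure.finsetSum_apply]
  have : ∀ s : Fin r × Bool, ((2 * r : ℝ≥0∞)⁻¹ • Measure.map (pickWord s)
      (Measure.infinitePi fun _ : ℕ =>
        (PMF.uniformOfFintype {a : Fin r × Bool // a ≠ invLetter s}).toMeasure)) Set.univ =
        (2 * r : ℝ≥0∞)⁻¹ := fun s => by
    rw [Measure.smul_apply, Measure.map_apply (measurable_pickWord s) .univ]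
    simp
  rw [Finset.sum_congr rfl fun s _ => this s]
  have h0 : (2 * r : ℝ≥0∞) ≠ 0 := by simp; omega
  have ht : (2 * r : ℝ≥0∞) ≠ ⊤ := ENNReal.mul_ne_top (by simp) (by simp)
  rw [Finset.sum_const, nsmul_eq_mul, Finset.card_univ, Fintype.card_prod, Fintype.card_fin,
    Fintype.card_bool, Nat.cast_mul, mul_comm (r : ℝ≥0∞)]
  exact ENNReal.mul_inv_cancel h0 ht

theorem measureReal_cyl (η : Boundary r) (n : ℕ) :
    (boundaryMeasure r).real (cyl η (n + 1)) = (2 * (r : ℝ))⁻¹ * (2 * (r : ℝ) - 1)⁻¹ ^ n := by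
  have hr : 1 ≤ r := Fin.pos (η.1 0).1
  rw [Measure.real, boundaryMeasure_cyl, ENNReal.toReal_mul, ENNReal.toReal_pow,
    ENNReal.toReal_inv, ENNReal.toReal_inv, ENNReal.toReal_natCast,
    Nat.cast_sub (show 1 ≤ 2 * r by omega)]
  simp

instance : T2Space (Boundary r) :=
  T2Space.of_injective_continuous Subtype.val_injective continuous_subtype_val

theorem integrable_of_continuous {E : Type*} [NormedAddCommGroup E] {g : Boundary r → E}
    (h : Continuous g) : Integrable g (boundaryMeasure r) := by
  rw [← integrableOn_univ]
  exact h.continuousOn.integrableOn_compact isCompact_univ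

/-- The map `ξ ↦ ξ₁ ⋯ ξₙ` pushes the boundary measure forward to the uniform measure on `Sₙ`. -/
theorem average_sphere (hr : 1 ≤ r) {E : Type*} [NormedAddCommGroup E] [NormedSpace ℝ E]
    [CompleteSpace E] (n : ℕ) (F : FreeGroup (Fin r) → E) :
    ((sphere r n).card : ℝ)⁻¹ • ∑ γ ∈ sphere r n, F γ = ∫ ξ, F (ξ.pre n) ∂boundaryMeasure r := by
  have := isProbabilityMeasure_boundaryMeasure hr
  -- all the sets `{ξ | ξ.pre n = γ}` have the same measure `c`
  obtain ⟨c, hc⟩ : ∃ c : ℝ, ∀ γ ∈ sphere r n,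
      (boundaryMeasure r).real {ξ | ξ.pre n = γ} = c := by
    have hcyl : ∀ η : Boundary r, {ξ : Boundary r | ξ.pre n = η.pre n} = cyl η n := fun η => by
      ext ξ
      exact Boundary.pre_eq_iff
    cases n with
    | zero =>
      refine ⟨1, fun γ h => ?_⟩
      obtain ⟨η, rfl⟩ := exists_pre_eq_of_mem_sphere hr h
      have : {ξ : Boundary r | ξ.pre 0 = η.pre 0} = Set.univ := Set.eq_univ_of_forall fun _ => rfl
      rw [this, probReal_univ]
    | succ n =>
      refine ⟨(2 * (r : ℝ))⁻¹ * (2 * (r : ℝ) - 1)⁻¹ ^ n, fun γ h => ?_⟩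
      obtain ⟨η, rfl⟩ := exists_pre_eq_of_mem_sphere hr h
      rw [hcyl, measureReal_cyl]
  have hms : ∀ γ, MeasurableSet {ξ : Boundary r | ξ.pre n = γ} := fun γ =>
    (continuous_Prop.1 (dependsOnPrefix_comp_pre n fun g => g = γ).continuous).measurableSet
  have key : ∫ ξ, F (ξ.pre n) ∂boundaryMeasure r = c • ∑ γ ∈ sphere r n, F γ := by
    have e : ∀ ξ : Boundary r, F (ξ.pre n) = ∑ γ ∈ sphere r n,
        Set.indicator {ξ : Boundary r | ξ.pre n = γ} (fun _ => F γ) ξ := fun ξ => by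
      rw [Finset.sum_eq_single (ξ.pre n)]
      · simp
      · intro γ _ h
        simp [h.symm]
      · exact fun h => absurd (pre_mem_sphere ξ n) h
    simp_rw [e]
    rw [integral_finsetSum _ fun γ _ => (integrable_const _).indicator (hms γ), Finset.smul_sum]
    refine Finset.sum_congr rfl fun γ h => ?_
    rw [integral_indicator_const _ (hms γ), hc γ h]
  have hcard : c * (sphere r n).card = 1 := by
    have h1 : ∑ γ ∈ sphere r n, (boundaryMeasure r).real {ξ | ξ.pre n = γ} = 1 := by
      rw [← measureReal_biUnion_finset]
      · convert probReal_univ (μ := boundaryMeasure r)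
        refine Set.eq_univ_of_forall fun ξ => Set.mem_biUnion (pre_mem_sphere ξ n) rfl
      · exact fun a _ b _ hab => Set.disjoint_left.2 fun ξ h1 h2 => hab (h1.symm.trans h2)
      · exact fun γ _ => hms γ
    rw [Finset.sum_congr rfl hc, Finset.sum_const, nsmul_eq_mul] at h1
    linarith
  rw [key, ← eq_inv_of_mul_eq_one_left hcard]

/-! ### The shift is mixing -/

/-- The Markov property of the boundary measure: given the first letter `s`, the rest of the word
is distributed as a word that does not begin with `s⁻¹`. -/
theorem integral_first_letter (s : Fin r × Bool) {Φ : Boundary r → ℂ} (hΦ : Measurable Φ) :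
    ∫ ξ, (if ξ.1 0 = s then Φ ξ.tail else 0) ∂boundaryMeasure r =
      (2 * (r : ℂ) - 1)⁻¹ * ∫ ξ, (if ξ.1 0 = invLetter s then 0 else Φ ξ) ∂boundaryMeasure r := by
  set Ψ : Boundary r → ℂ := fun ξ => if ξ.1 0 = s then Φ ξ.tail else 0 with hΨ
  have hΨm : Measurable Ψ := Measurable.ite (measurable_coord 0 (measurableSet_singleton _))
    (hΦ.comp continuous_tail.measurable) measurable_const
  have h1 : ∫ ξ, (if ξ.1 0 = invLetter s then 0 else Φ ξ) ∂boundaryMeasure r =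
      ∫ ξ, Ψ (ξ.letterMul s) ∂boundaryMeasure r := by
    congr 1
    funext ξ
    split_ifs with h
    · rw [Boundary.letterMul_of_eq h]
      refine (if_neg fun h' => ?_).symm
      apply ξ.ne_inv 0
      rw [h, invLetter_invLetter]
      exact h'
    · rw [Boundary.letterMul_of_ne h]
      exact (if_pos rfl).symm
  have hq : 2 * (r : ℂ) - 1 ≠ 0 := by
    have : (0 : ℝ) < 2 * (r : ℝ) - 1 := base_pos (constWord s)
    exact_mod_cast this.ne'
  have h2 : ∫ ξ, Ψ (ξ.letterMul s) ∂boundaryMeasure r =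
      ∫ ξ, (2 * (r : ℂ) - 1) * Ψ ξ ∂boundaryMeasure r := by
    rw [← integral_map (measurable_letterMul s).aemeasurable hΨm.aestronglyMeasurable, map_letter,
      integral_withDensity_eq_integral_toReal_smul (measurable_poisson _).ennreal_ofReal (by simp)]
    congr 1
    funext ξ
    rw [ENNReal.toReal_ofReal (poisson_pos _ _).le, poisson_letter]
    by_cases h : ξ.1 0 = s
    · rw [if_pos h, Complex.real_smul]
      push_cast
      rfl
    · simp [hΨ, h]
  rw [h1, h2, integral_const_mul, inv_mul_cancel_left₀ hq]

theorem sum_first_letter (ξ : Boundary r) (z : ℂ) :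
    ∑ s : Fin r × Bool, (if ξ.1 0 = s then z else 0) = z := by
  simp

theorem sum_first_letter_ne (ξ : Boundary r) (z : ℂ) :
    ∑ s : Fin r × Bool, (if ξ.1 0 = invLetter s then 0 else z) = (2 * (r : ℂ) - 1) * z := by
  have e : ∀ s : Fin r × Bool, (if ξ.1 0 = invLetter s then 0 else z) =
      z - if invLetter (ξ.1 0) = s then z else 0 := fun s => by
    have : ξ.1 0 = invLetter s ↔ invLetter (ξ.1 0) = s :=
      ⟨fun h => by rw [h, invLetter_invLetter], fun h => by rw [← h, invLetter_invLetter]⟩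
    simp only [this]
    split_ifs <;> simp
  simp only [e, Finset.sum_sub_distrib, Finset.sum_const, Finset.card_univ, Fintype.card_prod,
    Fintype.card_fin, Fintype.card_bool, Finset.sum_ite_eq, Finset.mem_univ, if_true, nsmul_eq_mul]
  push_cast
  ring

theorem integrable_ite (p : Boundary r → Prop) [DecidablePred p] (hp : MeasurableSet {ξ | p ξ})
    {Φ : Boundary r → ℂ} (h : Integrable Φ (boundaryMeasure r)) :
    Integrable (fun ξ => if p ξ then Φ ξ else 0) (boundaryMeasure r) :=
  (h.indicator hp).congr (ae_of_all _ fun _ => Set.indicator_apply _ _ _)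

theorem measurableSet_first (s : Fin r × Bool) : MeasurableSet {ξ : Boundary r | ξ.1 0 = s} :=
  measurable_coord 0 (measurableSet_singleton _)

theorem integral_eq_sum_first_letter {Φ : Boundary r → ℂ}
    (h : Integrable Φ (boundaryMeasure r)) :
    ∫ ξ, Φ ξ ∂boundaryMeasure r =
      ∑ s, ∫ ξ, (if ξ.1 0 = s then Φ ξ else 0) ∂boundaryMeasure r := by
  rw [← integral_finsetSum _ fun s _ => integrable_ite _ (measurableSet_first s) h]
  simp only [sum_first_letter]

/-- Shift-invariance of the boundary measure, one step at a time. -/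
theorem integral_comp_tail {Φ : Boundary r → ℂ} (hΦ : Continuous Φ) :
    ∫ ξ, Φ ξ.tail ∂boundaryMeasure r = ∫ ξ, Φ ξ ∂boundaryMeasure r := by
  rcases isEmpty_or_nonempty (Boundary r) with h | ⟨⟨ξ₀⟩⟩
  · simp [Measure.eq_zero_of_isEmpty]
  have hq : 2 * (r : ℂ) - 1 ≠ 0 := by exact_mod_cast (base_pos ξ₀).ne'
  rw [integral_eq_sum_first_letter (Φ := fun ξ => Φ ξ.tail)
    (integrable_of_continuous (hΦ.comp continuous_tail))]
  simp only [integral_first_letter _ hΦ.measurable]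
  rw [← Finset.mul_sum, ← integral_finsetSum _ fun s _ => ?_]
  · simp only [sum_first_letter_ne]
    rw [integral_const_mul, inv_mul_cancel_left₀ hq]
  · simpa only [ite_not] using integrable_ite (fun ξ => ¬ ξ.1 0 = invLetter s)
      (measurableSet_first _).compl (integrable_of_continuous hΦ)

theorem integral_comp_shift {Φ : Boundary r → ℂ} (hΦ : Continuous Φ) (m : ℕ) :
    ∫ ξ, Φ (ξ.shift m) ∂boundaryMeasure r = ∫ ξ, Φ ξ ∂boundaryMeasure r := by
  induction m with
  | zero => rfl
  | succ m ih =>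
    simp only [Boundary.shift_succ]
    exact (integral_comp_tail (hΦ.comp (continuous_shift m))).trans ih

/-- The discrepancy between the integral of `B ∘ shift m` over the words with first letter `s` and
its expected value, as a function of `s`, is divided by `-(2r - 1)` and reflected by `s ↦ s⁻¹` when
`m` grows by one. -/
theorem discrepancy_succ {B : Boundary r → ℂ} (hB : Continuous B) (m : ℕ) (s : Fin r × Bool) :
    ∫ ξ, (if ξ.1 0 = s then B (ξ.shift (m + 1)) else 0) ∂boundaryMeasure r -
        (2 * (r : ℂ))⁻¹ * ∫ ξ, B ξ ∂boundaryMeasure r =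
      -(2 * (r : ℂ) - 1)⁻¹ *
        (∫ ξ, (if ξ.1 0 = invLetter s then B (ξ.shift m) else 0) ∂boundaryMeasure r -
          (2 * (r : ℂ))⁻¹ * ∫ ξ, B ξ ∂boundaryMeasure r) := by
  have hq : 2 * (r : ℂ) - 1 ≠ 0 := by exact_mod_cast (base_pos (constWord s)).ne'
  have hr : (r : ℂ) ≠ 0 := Nat.cast_ne_zero.2 (Fin.pos s.1).ne'
  have hBm : Continuous fun ξ : Boundary r => B (ξ.shift m) := hB.comp (continuous_shift m)
  have e : ∫ ξ, (if ξ.1 0 = invLetter s then 0 else B (ξ.shift m)) ∂boundaryMeasure r =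
      ∫ ξ, B ξ ∂boundaryMeasure r -
        ∫ ξ, (if ξ.1 0 = invLetter s then B (ξ.shift m) else 0) ∂boundaryMeasure r := by
    rw [← integral_comp_shift hB m, ← integral_sub (integrable_of_continuous hBm)
      (integrable_ite _ (measurableSet_first _) (integrable_of_continuous hBm))]
    congr 1
    funext ξ
    split_ifs <;> simp
  have h := integral_first_letter s hBm.measurable
  simp only [← Boundary.shift_succ] at h
  rw [h, e]
  field_simp
  ring

theorem tendsto_discrepancy (hr : 2 ≤ r) {B : Boundary r → ℂ} (hB : Continuous B)
    (s : Fin r × Bool) :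
    Tendsto (fun m : ℕ => ∫ ξ, (if ξ.1 0 = s then B (ξ.shift m) else 0) ∂boundaryMeasure r) atTop
      (𝓝 ((2 * (r : ℂ))⁻¹ * ∫ ξ, B ξ ∂boundaryMeasure r)) := by
  set d : ℕ → Fin r × Bool → ℂ := fun m s =>
    ∫ ξ, (if ξ.1 0 = s then B (ξ.shift m) else 0) ∂boundaryMeasure r -
      (2 * (r : ℂ))⁻¹ * ∫ ξ, B ξ ∂boundaryMeasure r with hd
  have hq : (3 : ℝ) ≤ 2 * (r : ℝ) - 1 := by
    have : (2 : ℝ) ≤ r := by exact_mod_cast hr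
    linarith
  have hn : ‖-(2 * (r : ℂ) - 1)⁻¹‖ = (2 * (r : ℝ) - 1)⁻¹ := by
    have : (2 * (r : ℂ) - 1) = ((2 * (r : ℝ) - 1 : ℝ) : ℂ) := by push_cast; rfl
    rw [norm_neg, norm_inv, this, Complex.norm_real, Real.norm_of_nonneg (by linarith)]
  have hb : ∀ m s, ‖d m s‖ ≤ (2 * (r : ℝ) - 1)⁻¹ ^ m * ∑ t, ‖d 0 t‖ := by
    intro m
    induction m with
    | zero =>
      intro s
      rw [pow_zero, one_mul]
      exact Finset.single_le_sum (f := fun t => ‖d 0 t‖) (fun t _ => norm_nonneg _)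
        (Finset.mem_univ s)
    | succ m ih =>
      intro s
      have h : d (m + 1) s = _ := discrepancy_succ hB m s
      rw [h, norm_mul, hn, pow_succ', mul_assoc]
      exact mul_le_mul_of_nonneg_left (ih _) (inv_nonneg.2 (by linarith))
  rw [tendsto_iff_norm_sub_tendsto_zero]
  refine squeeze_zero (fun _ => norm_nonneg _) (fun m => hb m s) ?_
  simpa using (tendsto_pow_atTop_nhds_zero_of_lt_one (inv_nonneg.2 (by linarith))
    (inv_lt_one_of_one_lt₀ (by linarith : 1 < 2 * (r : ℝ) - 1))).mul_const (∑ t, ‖d 0 t‖)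

theorem Boundary.letterMul_tail {ξ : Boundary r} {s : Fin r × Bool} (h : ξ.1 0 = s) :
    ξ.tail.letterMul s = ξ := by
  have h' : ξ.1 0 = invLetter (invLetter s) := by rwa [invLetter_invLetter]
  have := letterMul_letterMul (invLetter s) ξ
  rwa [invLetter_invLetter, letterMul_of_eq h'] at this

theorem DependsOnPrefix.comp_letterMul {k : ℕ} {A : Boundary r → ℂ} (hA : DependsOnPrefix (k + 2) A)
    (s : Fin r × Bool) :
    DependsOnPrefix (k + 1) fun ξ => if ξ.1 0 = invLetter s then 0 else A (ξ.letterMul s) := by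
  intro ξ ζ h
  have h0 := h 0 (by omega)
  simp only [h0]
  split_ifs with hs
  · rfl
  · apply hA
    rw [Boundary.letterMul_of_ne hs, Boundary.letterMul_of_ne (h0 ▸ hs)]
    intro i hi
    cases i with
    | zero => rfl
    | succ i => exact h i (by omega)

theorem integral_mul_comp_shift_succ {k : ℕ} {A B : Boundary r → ℂ}
    (hA : DependsOnPrefix (k + 2) A) (hB : Continuous B) (m : ℕ) :
    ∫ ξ, A ξ * B (ξ.shift (m + 1)) ∂boundaryMeasure r = ∑ s, (2 * (r : ℂ) - 1)⁻¹ *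
      ∫ ξ, (if ξ.1 0 = invLetter s then 0 else A (ξ.letterMul s)) * B (ξ.shift m)
        ∂boundaryMeasure r := by
  rw [integral_eq_sum_first_letter (Φ := fun ξ => A ξ * B (ξ.shift (m + 1)))
    (integrable_of_continuous (hA.continuous.mul (hB.comp (continuous_shift (m + 1)))))]
  refine Finset.sum_congr rfl fun s _ => ?_
  have hm : Measurable fun ξ : Boundary r => A (ξ.letterMul s) * B (ξ.shift m) :=
    (hA.continuous.measurable.comp (measurable_letterMul s)).mul
      (hB.comp (continuous_shift m)).measurable
  have h := integral_first_letter s hm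
  simp only [ite_mul, zero_mul]
  rw [← h]
  congr 1
  funext ξ
  split_ifs with h0
  · rw [Boundary.letterMul_tail h0, Boundary.shift_succ]
  · rfl

theorem tendsto_integral_mul_comp_shift_of_dependsOnPrefix (hr : 2 ≤ r) {k : ℕ}
    {A B : Boundary r → ℂ} (hA : DependsOnPrefix (k + 1) A) (hB : Continuous B) :
    Tendsto (fun m : ℕ => ∫ ξ, A ξ * B (ξ.shift m) ∂boundaryMeasure r) atTop
      (𝓝 ((∫ ξ, A ξ ∂boundaryMeasure r) * ∫ ξ, B ξ ∂boundaryMeasure r)) := by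
  have := isProbabilityMeasure_boundaryMeasure (show 1 ≤ r by omega)
  induction k generalizing A with
  | zero =>
    -- a function of the first letter is a combination of indicators of the first letter
    have e : ∀ C : Boundary r → ℂ, Continuous C → ∫ ξ, A ξ * C ξ ∂boundaryMeasure r =
        ∑ s, A (constWord s) * ∫ ξ, (if ξ.1 0 = s then C ξ else 0) ∂boundaryMeasure r := by
      intro C hC
      rw [integral_eq_sum_first_letter (Φ := fun ξ => A ξ * C ξ)
        (integrable_of_continuous (hA.continuous.mul hC))]
      refine Finset.sum_congr rfl fun s _ => ?_
      rw [← integral_const_mul]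
      congr 1
      funext ξ
      split_ifs with h
      · have : A ξ = A (constWord s) := hA _ _ fun i hi => by
          obtain rfl : i = 0 := by omega
          exact h
        simp only [this]
      · simp
    have hm : ∀ m : ℕ, Continuous fun ξ : Boundary r => B (ξ.shift m) :=
      fun m => hB.comp (continuous_shift m)
    have e1 : ∫ ξ, A ξ ∂boundaryMeasure r = ∑ s, A (constWord s) * (2 * (r : ℂ))⁻¹ := by
      have h1 := e (fun _ => 1) continuous_const
      simp only [mul_one] at h1
      rw [h1]
      refine Finset.sum_congr rfl fun s _ => ?_
      have h2 := tendsto_discrepancy hr (B := fun _ => (1 : ℂ)) continuous_const s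
      have h3 := tendsto_nhds_unique h2 tendsto_const_nhds
      rw [← h3]
      simp
    simp only [e _ (hm _)]
    rw [e1, Finset.sum_mul]
    refine tendsto_finsetSum _ fun s _ => ?_
    rw [mul_assoc]
    exact (tendsto_discrepancy hr hB s).const_mul _
  | succ k ih =>
    -- splitting off the first letter leaves functions of one letter less
    rw [← tendsto_add_atTop_iff_nat 1]
    simp only [integral_mul_comp_shift_succ hA hB]
    have h1 := integral_mul_comp_shift_succ hA (B := fun _ => 1) continuous_const 0
    simp only [mul_one] at h1
    rw [h1, Finset.sum_mul]
    refine tendsto_finsetSum _ fun s _ => ?_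
    rw [mul_assoc]
    exact (ih (hA.comp_letterMul s)).const_mul _

/-! ### Uniformity by compactness of the boundary -/

theorem exists_cyl_subset {ξ : Boundary r} {U : Set (Boundary r)} (h : U ∈ 𝓝 ξ) :
    ∃ k, cyl ξ k ⊆ U := by
  obtain ⟨_, ⟨η, n, rfl⟩, hξ, hU⟩ := cyl_basis.mem_nhds_iff.1 h
  exact ⟨n + 2, fun ζ hζ => hU fun i hi => (hζ i hi).trans (hξ i hi)⟩

/-- A property that holds near each boundary point from some index on holds everywhere from some
index on. -/
theorem exists_forall_of_locally {P : ℕ → Boundary r → Prop}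
    (h : ∀ ξ₀ : Boundary r, ∃ k, ∀ ξ ∈ cyl ξ₀ k, ∀ n ≥ k, P n ξ) : ∃ N, ∀ n ≥ N, ∀ ξ, P n ξ := by
  choose k hk using h
  obtain ⟨t, ht⟩ := CompactSpace.elim_nhds_subcover (fun ξ => cyl ξ (k ξ))
    fun ξ => (isOpen_cyl ξ _).mem_nhds fun _ _ => rfl
  refine ⟨t.sup k, fun n hn ξ => ?_⟩
  obtain ⟨ξ₀, h0, h1⟩ := Set.mem_iUnion₂.1 (ht.ge (Set.mem_univ ξ))
  exact hk ξ₀ ξ h1 n ((Finset.le_sup h0).trans hn)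

theorem exists_norm_sub_lt {E : Type*} [SeminormedAddCommGroup E] {A : Boundary r → E}
    (hA : Continuous A) {ε : ℝ} (hε : 0 < ε) :
    ∃ k, ∀ ξ, ∀ ζ ∈ cyl ξ k, ‖A ζ - A ξ‖ < ε := by
  obtain ⟨N, hN⟩ := exists_forall_of_locally (P := fun n ξ => ∀ ζ ∈ cyl ξ n, ‖A ζ - A ξ‖ < ε)
    fun ξ₀ => by
      obtain ⟨k, hk⟩ := exists_cyl_subset (hA.continuousAt (Metric.ball_mem_nhds (A ξ₀)
        (half_pos hε)))
      refine ⟨k, fun ξ hξ n hn ζ hζ => ?_⟩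
      have h1 := hk hξ
      have h2 := hk (show ζ ∈ cyl ξ₀ k from fun i hi => (hζ i (by omega)).trans (hξ i hi))
      simp only [Set.mem_preimage, Metric.mem_ball] at h1 h2
      rw [← dist_eq_norm]
      have := dist_triangle_right (A ζ) (A ξ) (A ξ₀)
      linarith
  exact ⟨N, hN N le_rfl⟩

theorem exists_dependsOnPrefix_norm_sub_lt {E : Type*} [SeminormedAddCommGroup E]
    {A : Boundary r → E} (hA : Continuous A) {ε : ℝ} (hε : 0 < ε) :
    ∃ (k : ℕ) (A' : Boundary r → E), DependsOnPrefix (k + 1) A' ∧ ∀ ξ, ‖A ξ - A' ξ‖ < ε := by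
  obtain ⟨k, hk⟩ := exists_norm_sub_lt hA hε
  -- the word that repeats the letter of `ξ` at position `k` from there on
  let T : Boundary r → Boundary r := fun ξ => ⟨fun i => ξ.1 (min i k), fun i => by
    change (ξ.1 (min i k)).1 = (ξ.1 (min (i + 1) k)).1 →
      (ξ.1 (min i k)).2 = (ξ.1 (min (i + 1) k)).2
    rcases lt_or_ge i k with h | h
    · rw [min_eq_left h.le, min_eq_left (show i + 1 ≤ k by omega)]
      exact ξ.2 i
    · rw [min_eq_right h, min_eq_right (show k ≤ i + 1 by omega)]
      exact fun _ => rfl⟩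
  refine ⟨k, fun ξ => A (T ξ), fun ξ ζ h => congrArg A ?_, fun ξ => hk (T ξ) ξ ?_⟩
  · exact Boundary.ext fun i => h _ (by omega)
  · intro i hi
    exact (congrArg ξ.1 (min_eq_left hi.le)).symm

/-- The shift on the boundary is mixing. -/
theorem tendsto_integral_mul_comp_shift (hr : 2 ≤ r) {A B : Boundary r → ℂ} (hA : Continuous A)
    (hB : Continuous B) :
    Tendsto (fun m : ℕ => ∫ ξ, A ξ * B (ξ.shift m) ∂boundaryMeasure r) atTop
      (𝓝 ((∫ ξ, A ξ ∂boundaryMeasure r) * ∫ ξ, B ξ ∂boundaryMeasure r)) := by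
  have := isProbabilityMeasure_boundaryMeasure (show 1 ≤ r by omega)
  obtain ⟨C, hC, hCB⟩ := continuous_bounded hB
  rw [Metric.tendsto_atTop]
  intro ε hε
  obtain ⟨k, A', hA', hAA⟩ := exists_dependsOnPrefix_norm_sub_lt hA
    (show 0 < ε / (3 * (C + 1)) by positivity)
  have hb : ∀ D : Boundary r → ℂ, Continuous D → (∀ ξ, ‖D ξ‖ ≤ C) →
      ‖∫ ξ, A ξ * D ξ ∂boundaryMeasure r - ∫ ξ, A' ξ * D ξ ∂boundaryMeasure r‖ ≤ ε / 3 := by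
    intro D hD hDC
    rw [← integral_sub (f := fun ξ => A ξ * D ξ) (g := fun ξ => A' ξ * D ξ)
      (integrable_of_continuous (hA.mul hD)) (integrable_of_continuous (hA'.continuous.mul hD))]
    refine (norm_integral_le_of_norm_le_const (ae_of_all _ fun ξ => ?_)).trans
      (by rw [probReal_univ, mul_one])
    rw [← sub_mul, norm_mul]
    calc ‖A ξ - A' ξ‖ * ‖D ξ‖ ≤ ε / (3 * (C + 1)) * (C + 1) :=
          mul_le_mul (hAA ξ).le ((hDC ξ).trans (by linarith)) (norm_nonneg _) (by positivity)
      _ = ε / 3 := by field_simp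
  obtain ⟨N, hN⟩ := Metric.tendsto_atTop.1
    (tendsto_integral_mul_comp_shift_of_dependsOnPrefix hr hA' hB) (ε / 3) (by positivity)
  refine ⟨N, fun m hm => ?_⟩
  have h1 := hb _ (hB.comp (continuous_shift m)) fun ξ => hCB _
  have h2 := hN m hm
  have h3 := hb (fun _ => ∫ ξ, B ξ ∂boundaryMeasure r) continuous_const fun _ =>
    (norm_integral_le_of_norm_le_const (ae_of_all _ hCB)).trans (by rw [probReal_univ, mul_one])
  rw [integral_mul_const, integral_mul_const, norm_sub_rev] at h3
  rw [← dist_eq_norm] at h1 h3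
  simp only [Function.comp_apply] at h1
  have h4 := dist_triangle4 (∫ ξ, A ξ * B (ξ.shift m) ∂boundaryMeasure r)
    (∫ ξ, A' ξ * B (ξ.shift m) ∂boundaryMeasure r)
    ((∫ ξ, A' ξ ∂boundaryMeasure r) * ∫ ξ, B ξ ∂boundaryMeasure r)
    ((∫ ξ, A ξ ∂boundaryMeasure r) * ∫ ξ, B ξ ∂boundaryMeasure r)
  linarith

/-! ### Continuous functions on the compactification -/

theorem isFloor_vertex (g : FreeGroup (Fin r)) : IsFloor (vertex g) g := by
  refine ⟨?_, fun h _ => ?_⟩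
  · simp [geodesic]
  · rw [dist_self]
    exact dist_nonneg

theorem orbitValue_eq (f : C(Compactification r, ℂ)) (γ : FreeGroup (Fin r)) :
    orbitValue f γ = f (.ofTree (vertex γ)) := by
  rw [orbitValue, basePoint, smul_vertex, mul_one]

/-- The values of a continuous function at the vertices along a ray converge to its value at the
end of the ray, uniformly in the ray. -/
theorem exists_orbitValue_sub_lt (f : C(Compactification r, ℂ)) {ε : ℝ} (hε : 0 < ε) :
    ∃ N, ∀ n ≥ N, ∀ ξ : Boundary r, ‖orbitValue f (ξ.pre n) - restrictBoundary f ξ‖ < ε := by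
  refine exists_forall_of_locally fun ξ₀ => ?_
  have hU : IsOpen (f ⁻¹' Metric.ball (f (.ofBoundary ξ₀)) (ε / 2)) :=
    Metric.isOpen_ball.preimage f.continuous
  obtain ⟨_, ⟨k, rfl⟩, hk⟩ := hU.2 ξ₀ (Metric.mem_ball_self (half_pos hε))
  refine ⟨k, fun ξ hξ n hn => ?_⟩
  have hpre : ξ₀.pre k = ξ.pre k := (Boundary.pre_eq_iff.2 hξ).symm
  have h1 : f (.ofTree (vertex (ξ.pre n))) ∈ Metric.ball (f (.ofBoundary ξ₀)) (ε / 2) :=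
    hk (Or.inl ⟨_, ⟨_, isFloor_vertex _, hpre ▸ ξ.pre_prefix hn⟩, rfl⟩)
  have h2 : f (.ofBoundary ξ) ∈ Metric.ball (f (.ofBoundary ξ₀)) (ε / 2) :=
    hk (Or.inr ⟨_, ⟨k, hpre⟩, rfl⟩)
  rw [orbitValue_eq, ← dist_eq_norm]
  rw [Metric.mem_ball] at h1 h2
  have := dist_triangle_right (f (.ofTree (vertex (ξ.pre n)))) (f (.ofBoundary ξ))
    (f (.ofBoundary ξ₀))
  change dist (f (.ofTree (vertex (ξ.pre n)))) (f (.ofBoundary ξ)) < ε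
  linarith

/-! ### The Poisson kernel and the Harish-Chandra function -/

/-- The length of the longest common prefix of `η` and `ξ`, capped at `n`. -/
def overlap : ℕ → Boundary r → Boundary r → ℕ
  | 0, _, _ => 0
  | n + 1, η, ξ => if η.1 0 = ξ.1 0 then overlap n η.tail ξ.tail + 1 else 0

theorem overlap_comm (n : ℕ) (η ξ : Boundary r) : overlap n η ξ = overlap n ξ η := by
  induction n generalizing η ξ with
  | zero => rfl
  | succ n ih => simp only [overlap, eq_comm (a := η.1 0), ih]

theorem mem_cyl_of_le_overlap {n k : ℕ} {η ξ : Boundary r} (h : k ≤ overlap n η ξ) :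
    ξ ∈ cyl η k := by
  induction n generalizing η ξ k with
  | zero => exact fun i hi => by simp only [overlap] at h; omega
  | succ n ih =>
    intro i hi
    rw [overlap] at h
    split_ifs at h with h0
    · cases i with
      | zero => exact h0.symm
      | succ i =>
        exact ih (k := k - 1) (η := η.tail) (ξ := ξ.tail) (by omega) i (by omega)
    · omega

theorem mem_cyl_add_two_iff {j : ℕ} {η ξ : Boundary r} :
    ξ ∈ cyl η (j + 2) ↔ η.1 0 = ξ.1 0 ∧ ξ.tail ∈ cyl η.tail (j + 1) := by
  constructor
  · exact fun h => ⟨(h 0 (by omega)).symm, fun i hi => h (i + 1) (by omega)⟩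
  · rintro ⟨h0, h⟩ i hi
    cases i with
    | zero => exact h0.symm
    | succ i => exact h i (by omega)

open scoped Classical in
/-- Telescoping of the powers of `x` along the common prefix. -/
theorem pow_overlap (x : ℝ) (n : ℕ) (η ξ : Boundary r) :
    x ^ overlap n η ξ =
      1 + ∑ j ∈ Finset.range n, (x ^ (j + 1) - x ^ j) * (if ξ ∈ cyl η (j + 1) then 1 else 0) := by
  induction n generalizing η ξ with
  | zero => simp [overlap]
  | succ n ih =>
    rw [overlap, Finset.sum_range_succ']
    have h1 : ξ ∈ cyl η (0 + 1) ↔ η.1 0 = ξ.1 0 :=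
      ⟨fun h => (h 0 (by omega)).symm, fun h i hi => by
        obtain rfl : i = 0 := by omega
        exact h.symm⟩
    by_cases h0 : η.1 0 = ξ.1 0
    · have e : ∀ j ∈ Finset.range n, (x ^ (j + 1 + 1) - x ^ (j + 1)) *
          (if ξ ∈ cyl η (j + 1 + 1) then (1 : ℝ) else 0) =
          x * ((x ^ (j + 1) - x ^ j) * (if ξ.tail ∈ cyl η.tail (j + 1) then 1 else 0)) := by
        intro j _
        simp only [mem_cyl_add_two_iff, h0, true_and]
        ring
      rw [if_pos h0, if_pos (h1.2 h0), Finset.sum_congr rfl e, ← Finset.mul_sum, pow_succ, ih]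
      ring
    · have e : ∀ j ∈ Finset.range n, (x ^ (j + 1 + 1) - x ^ (j + 1)) *
          (if ξ ∈ cyl η (j + 1 + 1) then (1 : ℝ) else 0) = 0 := by
        intro j _
        simp only [mem_cyl_add_two_iff, h0, false_and, if_false, mul_zero]
      rw [if_neg h0, if_neg (mt h1.1 h0), Finset.sum_congr rfl e]
      simp

theorem dependsOnPrefix_overlap (n : ℕ) (η : Boundary r) : DependsOnPrefix n (overlap n η) := by
  induction n generalizing η with
  | zero => exact fun _ _ _ => rfl
  | succ n ih =>
    intro ξ ζ h
    rw [overlap, overlap, h 0 (by omega),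
      ih η.tail ξ.tail ζ.tail fun i hi => h (i + 1) (by omega)]

/-- The normalizing constant `∫ (2r - 1) ^ overlap n η ξ dμ(ξ)`, which does not depend on `η`. -/
def overlapMass (r n : ℕ) : ℝ := 1 + n * ((2 * r - 2) / (2 * r))

theorem integral_pow_overlap (n : ℕ) (η : Boundary r) :
    ∫ ξ, (2 * (r : ℝ) - 1) ^ overlap n η ξ ∂boundaryMeasure r = overlapMass r n := by
  classical
  have hr : 1 ≤ r := Fin.pos (η.1 0).1
  have := isProbabilityMeasure_boundaryMeasure hr
  have hq := base_pos η
  have hind : ∀ (j : ℕ) (ξ : Boundary r), (if ξ ∈ cyl η (j + 1) then (1 : ℝ) else 0) =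
      Set.indicator (cyl η (j + 1)) (fun _ => 1) ξ := fun j ξ => by rw [Set.indicator_apply]
  simp only [pow_overlap, hind]
  have hint : ∀ j, Integrable (fun ξ => ((2 * (r : ℝ) - 1) ^ (j + 1) - (2 * (r : ℝ) - 1) ^ j) *
      Set.indicator (cyl η (j + 1)) (fun _ => (1 : ℝ)) ξ) (boundaryMeasure r) := fun j =>
    ((integrable_const _).indicator (measurableSet_cyl η _)).const_mul _
  rw [integral_add (integrable_const _) (integrable_finsetSum _ fun j _ => hint j),
    integral_finsetSum _ fun j _ => hint j]
  have e : ∀ j ∈ Finset.range n, ∫ ξ, ((2 * (r : ℝ) - 1) ^ (j + 1) - (2 * (r : ℝ) - 1) ^ j) *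
      Set.indicator (cyl η (j + 1)) (fun _ => (1 : ℝ)) ξ ∂boundaryMeasure r =
      (2 * r - 2) / (2 * r) := by
    intro j _
    have hr0 : (r : ℝ) ≠ 0 := by positivity
    rw [integral_const_mul, integral_indicator_const _ (measurableSet_cyl η _), measureReal_cyl,
      smul_eq_mul, mul_one, inv_pow, pow_succ]
    field_simp
    ring
  rw [Finset.sum_congr rfl e]
  simp [overlapMass]

theorem one_le_overlapMass (hr : 1 ≤ r) (n : ℕ) : 1 ≤ overlapMass r n := by
  have : (1 : ℝ) ≤ r := by exact_mod_cast hr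
  rw [overlapMass, le_add_iff_nonneg_right]
  exact mul_nonneg (by positivity) (div_nonneg (by linarith) (by positivity))

theorem tendsto_overlapMass (hr : 2 ≤ r) : Tendsto (overlapMass r) atTop atTop := by
  have : (2 : ℝ) ≤ r := by exact_mod_cast hr
  exact tendsto_atTop_add_const_left _ _ (tendsto_natCast_atTop_atTop.atTop_mul_const
    (div_pos (by linarith) (by linarith)))

theorem busemann_pre (n : ℕ) (η ξ : Boundary r) :
    busemann ξ (basePoint r) (η.pre n • basePoint r) = 2 * overlap n η ξ - n := by
  induction n generalizing η ξ with
  | zero => rw [Boundary.pre_zero, busemann_one]; simp [overlap]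
  | succ n ih =>
    rw [Boundary.pre_succ, busemann_mul, ih, overlap, letterBusemann]
    by_cases h : ξ.1 0 = η.1 0
    · rw [if_pos h, if_pos h.symm, Boundary.letterMul_of_eq (by rwa [invLetter_invLetter])]
      push_cast
      ring
    · rw [if_neg h, if_neg (Ne.symm h),
        Boundary.letterMul_of_ne (by rwa [invLetter_invLetter] : ξ.1 0 ≠ invLetter (invLetter _))]
      have h0 : ∀ h', overlap n η.tail (ξ.cons (invLetter (η.1 0)) h') = 0 := by
        intro h'
        cases n with
        | zero => rfl
        | succ n => exact if_neg (η.ne_inv 0)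
      rw [h0]
      push_cast
      ring

theorem sqrt_poisson_pre (n : ℕ) (η ξ : Boundary r) :
    poisson (η.pre n) ξ ^ (1 / 2 : ℝ) =
      (2 * (r : ℝ) - 1) ^ (-(n / 2 : ℝ)) * (2 * (r : ℝ) - 1) ^ overlap n η ξ := by
  rw [poisson, busemann_pre, ← Real.rpow_mul (base_pos ξ).le, ← Real.rpow_natCast,
    ← Real.rpow_add (base_pos ξ)]
  congr 1
  ring

/-- The Harish-Chandra function is radial: `Ξ(γ) = (2r - 1)^(-n/2) (1 + n (r - 1) / r)` for
`|γ| = n`. -/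
theorem harishChandra_pre (n : ℕ) (η : Boundary r) :
    harishChandra (η.pre n) = (2 * (r : ℝ) - 1) ^ (-(n / 2 : ℝ)) * overlapMass r n := by
  simp only [harishChandra, sqrt_poisson_pre]
  rw [integral_const_mul, integral_pow_overlap]

/-- The density `P(γ, ·)^{1/2} / Ξ(γ)` of a probability measure on the boundary. -/
def rootDensity (γ : FreeGroup (Fin r)) (ξ : Boundary r) : ℝ :=
  poisson γ ξ ^ (1 / 2 : ℝ) / harishChandra γ

theorem rootDensity_pre (n : ℕ) (η ξ : Boundary r) :
    rootDensity (η.pre n) ξ = (2 * (r : ℝ) - 1) ^ overlap n η ξ / overlapMass r n := by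
  rw [rootDensity, sqrt_poisson_pre, harishChandra_pre,
    mul_div_mul_left _ _ (Real.rpow_pos_of_pos (base_pos ξ) _).ne']

theorem rootDensity_nonneg (γ : FreeGroup (Fin r)) (ξ : Boundary r) : 0 ≤ rootDensity γ ξ :=
  div_nonneg (Real.rpow_nonneg (poisson_pos γ ξ).le _)
    (integral_nonneg fun _ => Real.rpow_nonneg (poisson_pos γ _).le _)

theorem continuous_rootDensity (γ : FreeGroup (Fin r)) : Continuous (rootDensity γ) := by
  rcases isEmpty_or_nonempty (Boundary r) with h | ⟨⟨ξ₀⟩⟩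
  · exact continuous_of_discreteTopology
  · obtain ⟨η, hη⟩ := exists_pre_eq (Fin.pos (ξ₀.1 0).1) γ
    have : rootDensity γ = fun ξ => (2 * (r : ℝ) - 1) ^ overlap γ.norm η ξ /
        overlapMass r γ.norm := by
      funext ξ
      rw [← rootDensity_pre, hη]
    rw [this]
    exact DependsOnPrefix.continuous (k := γ.norm) fun ξ ζ h => by
      simp only [dependsOnPrefix_overlap γ.norm η ξ ζ h]

theorem integral_rootDensity (hr : 1 ≤ r) (γ : FreeGroup (Fin r)) :
    ∫ ξ, rootDensity γ ξ ∂boundaryMeasure r = 1 := by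
  obtain ⟨η, hη⟩ := exists_pre_eq hr γ
  rw [← hη]
  simp only [rootDensity_pre]
  rw [integral_div, integral_pow_overlap]
  exact div_self (zero_lt_one.trans_le (one_le_overlapMass hr _)).ne'

/-- The average of the densities over a sphere is the constant function `1`, by the symmetry of
`overlap`. This is the identity `Mₙ(1) 1 = 1`. -/
theorem average_rootDensity (n : ℕ) (ξ : Boundary r) :
    ((sphere r n).card : ℝ)⁻¹ * ∑ γ ∈ sphere r n, rootDensity γ ξ = 1 := by
  have hr : 1 ≤ r := Fin.pos (ξ.1 0).1
  rw [← smul_eq_mul, average_sphere hr n fun γ => rootDensity γ ξ]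
  simp only [rootDensity_pre, overlap_comm n _ ξ]
  rw [integral_div, integral_pow_overlap]
  exact div_self (zero_lt_one.trans_le (one_le_overlapMass hr _)).ne'

theorem harishChandra_inv (γ : FreeGroup (Fin r)) : harishChandra γ⁻¹ = harishChandra γ := by
  rcases isEmpty_or_nonempty (Boundary r) with h | ⟨⟨ξ₀⟩⟩
  · simp [harishChandra, Measure.eq_zero_of_isEmpty]
  · obtain ⟨η, hη⟩ := exists_pre_eq (Fin.pos (ξ₀.1 0).1) γ
    rw [← hη, Boundary.inv_pre, harishChandra_pre, harishChandra_pre]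

/-- The translate by `γ⁻¹` of the probability measure with density `P(γ, ·)^{1/2} / Ξ(γ)` is the
one that belongs to `γ⁻¹`. -/
theorem integral_rootDensity_smul {E : Type*} [NormedAddCommGroup E] [NormedSpace ℝ E]
    (γ : FreeGroup (Fin r)) {F : Boundary r → E} (hF : StronglyMeasurable F) :
    ∫ ξ, rootDensity γ ξ • F (γ⁻¹ • ξ) ∂boundaryMeasure r =
      ∫ ξ, rootDensity γ⁻¹ ξ • F ξ ∂boundaryMeasure r := by
  -- `Φ` is the integrand divided by the density `P(γ, ·)` of the image of `μ` under `γ`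
  set Φ : Boundary r → E := fun ξ =>
    ((poisson γ ξ ^ (1 / 2 : ℝ))⁻¹ / harishChandra γ) • F (γ⁻¹ • ξ)
  have hΦ : StronglyMeasurable Φ :=
    ((((measurable_poisson γ).pow_const _).inv.div_const _).stronglyMeasurable).smul
      (hF.comp_measurable (measurable_action γ⁻¹))
  have h1 : ∫ ξ, Φ (γ • ξ) ∂boundaryMeasure r =
      ∫ ξ, rootDensity γ ξ • F (γ⁻¹ • ξ) ∂boundaryMeasure r := by
    rw [← integral_map (measurable_action γ).aemeasurable hΦ.aestronglyMeasurable, map_action,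
      integral_withDensity_eq_integral_toReal_smul (measurable_poisson _).ennreal_ofReal (by simp)]
    congr 1
    funext ξ
    have hp := poisson_pos γ ξ
    have hs : 0 < poisson γ ξ ^ (1 / 2 : ℝ) := Real.rpow_pos_of_pos hp _
    have hm : poisson γ ξ = poisson γ ξ ^ (1 / 2 : ℝ) * poisson γ ξ ^ (1 / 2 : ℝ) := by
      rw [← Real.rpow_add hp]
      norm_num
    rw [ENNReal.toReal_ofReal hp.le, smul_smul, rootDensity, mul_div_assoc']
    congr 2
    nth_rewrite 1 [hm]
    rw [mul_assoc, mul_inv_cancel₀ hs.ne', mul_one]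
  rw [← h1]
  congr 1
  funext ξ
  have h2 : poisson γ⁻¹ ξ = (poisson γ (γ • ξ))⁻¹ := by
    have := poisson_mul γ⁻¹ γ ξ
    rw [inv_mul_cancel, poisson_one, inv_inv] at this
    exact eq_inv_of_mul_eq_one_left this.symm
  simp only [Φ, inv_smul_smul, rootDensity, h2, harishChandra_inv]
  rw [Real.inv_rpow (poisson_pos _ _).le]

/-- The probability measures with density `P(γ, ·)^{1/2} / Ξ(γ)` concentrate near `γ`. -/
theorem rootDensity_le_of_notMem (hr : 1 ≤ r) {n k : ℕ} {η ξ : Boundary r} (h : ξ ∉ cyl η k) :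
    rootDensity (η.pre n) ξ ≤ (2 * (r : ℝ) - 1) ^ k / overlapMass r n := by
  have h1 : (1 : ℝ) ≤ r := by exact_mod_cast hr
  rw [rootDensity_pre]
  refine div_le_div_of_nonneg_right (pow_le_pow_right₀ (by linarith) ?_)
    (zero_le_one.trans (one_le_overlapMass hr n))
  by_contra hc
  exact h (mem_cyl_of_le_overlap (not_le.1 hc).le)

theorem integral_rootDensity_norm_sub_le (hr : 1 ≤ r) {k : ℕ} {u : Boundary r → ℂ}
    (hu : DependsOnPrefix k u) {C : ℝ} (hC : ∀ ξ, ‖u ξ‖ ≤ C) (n : ℕ) (η : Boundary r) :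
    ∫ ξ, rootDensity (η.pre n) ξ * ‖u ξ - u η‖ ∂boundaryMeasure r ≤
      (2 * (r : ℝ) - 1) ^ k / overlapMass r n * (2 * C) := by
  have := isProbabilityMeasure_boundaryMeasure hr
  have hZ := one_le_overlapMass hr n
  have hq := base_pos η
  have hC0 : 0 ≤ C := (norm_nonneg _).trans (hC η)
  refine (integral_mono (g := fun _ => (2 * (r : ℝ) - 1) ^ k / overlapMass r n * (2 * C))
    (integrable_of_continuous ?_) (integrable_const _) fun ξ => ?_).trans (by simp)
  · exact (continuous_rootDensity _).mul (hu.continuous.sub continuous_const).norm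
  · by_cases h : ξ ∈ cyl η k
    · simp only [hu ξ η h, sub_self, norm_zero, mul_zero]
      positivity
    · refine mul_le_mul (rootDensity_le_of_notMem hr h) ?_ (norm_nonneg _) (by positivity)
      have := norm_sub_le (u ξ) (u η)
      linarith [hC ξ, hC η]

/-! ### Matrix coefficients -/

/-- `L²` classes of functions that depend on finitely many letters only. -/
def cylindrical (r : ℕ) : Set (L2 r) :=
  {g | ∃ (k : ℕ) (u : Boundary r → ℂ), DependsOnPrefix k u ∧ g =ᵐ[boundaryMeasure r] u}

theorem dense_cylindrical (r : ℕ) : Dense (cylindrical r) := by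
  have hC : DenseRange (ContinuousMap.toLp 2 (boundaryMeasure r) ℂ :
    C(Boundary r, ℂ) →L[ℂ] L2 r) := ContinuousMap.toLp_denseRange ℂ _ ℂ (by simp)
  intro g
  rw [Metric.mem_closure_iff]
  intro ε hε
  obtain ⟨A, hA⟩ := Metric.denseRange_iff.1 hC g (ε / 2) (half_pos hε)
  set T : C(Boundary r, ℂ) →L[ℂ] L2 r := ContinuousMap.toLp 2 (boundaryMeasure r) ℂ with hT
  obtain ⟨k, A', hA', hAA⟩ := exists_dependsOnPrefix_norm_sub_lt A.continuous
    (show 0 < ε / (2 * (‖T‖ + 1)) by positivity)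
  have hd : dist (T A) (T ⟨A', hA'.continuous⟩) < ε / 2 := by
    rw [dist_eq_norm, ← map_sub]
    have h1 : ‖A - ⟨A', hA'.continuous⟩‖ ≤ ε / (2 * (‖T‖ + 1)) :=
      (ContinuousMap.norm_le _ (by positivity)).2 fun ξ => (hAA ξ).le
    calc ‖T (A - ⟨A', hA'.continuous⟩)‖ ≤ ‖T‖ * (ε / (2 * (‖T‖ + 1))) :=
          (T.le_opNorm _).trans (mul_le_mul_of_nonneg_left h1 (norm_nonneg _))
      _ < (‖T‖ + 1) * (ε / (2 * (‖T‖ + 1))) := mul_lt_mul_of_pos_right (by linarith) (by positivity)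
      _ = ε / 2 := by field_simp
  refine ⟨T ⟨A', hA'.continuous⟩, ⟨_, A', hA', ContinuousMap.coeFn_toLp _ _⟩, ?_⟩
  have := dist_triangle g (T A) (T ⟨A', hA'.continuous⟩)
  linarith

theorem norm_sq_eq_integral {g : L2 r} {u : Boundary r → ℂ} (h : g =ᵐ[boundaryMeasure r] u) :
    ‖g‖ ^ 2 = ∫ ξ, ‖u ξ‖ ^ 2 ∂boundaryMeasure r := by
  have h1 : ((‖g‖ ^ 2 : ℝ) : ℂ) = ((∫ ξ, ‖u ξ‖ ^ 2 ∂boundaryMeasure r : ℝ) : ℂ) := by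
    rw [Complex.ofReal_pow, ← Complex.coe_algebraMap, ← inner_self_eq_norm_sq_to_K (𝕜 := ℂ) g,
      L2.inner_def]
    refine Eq.trans ?_ integral_ofReal
    refine integral_congr_ae ?_
    filter_upwards [h] with ξ hξ
    rw [hξ, inner_self_eq_norm_sq_to_K]
    push_cast
    rfl
  exact_mod_cast h1

/-- The matrix coefficient `⟨π(γ) u, v⟩ / Ξ(γ)`. -/
def matrixCoeff (γ : FreeGroup (Fin r)) (u v : Boundary r → ℂ) : ℂ :=
  ∫ ξ, rootDensity γ ξ • (u (γ⁻¹ • ξ) * starRingEnd ℂ (v ξ)) ∂boundaryMeasure r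

theorem inner_quasiRegular_div {g h : L2 r} {u v : Boundary r → ℂ}
    (hg : g =ᵐ[boundaryMeasure r] u) (hh : h =ᵐ[boundaryMeasure r] v) (γ : FreeGroup (Fin r)) :
    inner ℂ h (quasiRegular r γ g) / (harishChandra γ : ℂ) = matrixCoeff γ u v := by
  rw [matrixCoeff, L2.inner_def, ← integral_div]
  refine integral_congr_ae ?_
  filter_upwards [hh, quasiRegular_coeFn γ g, quasiRegularFun_congr γ hg] with ξ h1 h2 h3
  rw [h1, h2, h3, RCLike.inner_apply, quasiRegularFun, rootDensity, Complex.real_smul]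
  push_cast
  ring

theorem inner_average (f : C(Compactification r, ℂ)) (n : ℕ) (g h : L2 r) :
    inner ℂ h (average f n g) = ((sphere r n).card : ℂ)⁻¹ *
      ∑ γ ∈ sphere r n, orbitValue f γ *
        (inner ℂ h (quasiRegular r γ g) / (harishChandra γ : ℂ)) := by
  rw [average, smul_apply, inner_smul_right, sum_apply,
    inner_sum]
  congr 1
  refine Finset.sum_congr rfl fun γ _ => ?_
  rw [smul_apply, inner_smul_right, div_mul_eq_mul_div, mul_div_assoc]
  rfl

theorem integrable_of_measurable_of_bound {E : Type*} [NormedAddCommGroup E] {F : Boundary r → E}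
    (hF : StronglyMeasurable F) {C : ℝ} (hC : ∀ ξ, ‖F ξ‖ ≤ C) :
    Integrable F (boundaryMeasure r) :=
  .of_bound hF.aestronglyMeasurable C (ae_of_all _ hC)

theorem integrable_rootDensity_smul {E : Type*} [NormedAddCommGroup E] [NormedSpace ℝ E]
    (γ : FreeGroup (Fin r)) {F : Boundary r → E} (hF : Continuous F) :
    Integrable (fun ξ => rootDensity γ ξ • F (γ⁻¹ • ξ)) (boundaryMeasure r) := by
  obtain ⟨C, hC, hFC⟩ := continuous_bounded hF
  obtain ⟨R, hR, hRC⟩ := continuous_bounded (continuous_rootDensity γ)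
  refine integrable_of_measurable_of_bound (C := R * C)
    ((continuous_rootDensity γ).stronglyMeasurable.smul
      (hF.stronglyMeasurable.comp_measurable (measurable_action γ⁻¹))) fun ξ => ?_
  rw [norm_smul]
  exact mul_le_mul (hRC ξ) (hFC _) (norm_nonneg _) hR

theorem norm_matrixCoeff_le (γ : FreeGroup (Fin r)) {u v : Boundary r → ℂ} (hu : Continuous u)
    (hv : Continuous v) :
    ‖matrixCoeff γ u v‖ ≤ 1 / 2 * (∫ ξ, rootDensity γ⁻¹ ξ * ‖u ξ‖ ^ 2 ∂boundaryMeasure r +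
      ∫ ξ, rootDensity γ ξ * ‖v ξ‖ ^ 2 ∂boundaryMeasure r) := by
  have hU : Continuous fun ξ => ‖u ξ‖ ^ 2 := hu.norm.pow 2
  have h1 := integral_rootDensity_smul γ hU.stronglyMeasurable
  simp only [smul_eq_mul] at h1
  have i1 := integrable_rootDensity_smul γ hU
  have i2 : Integrable (fun ξ => rootDensity γ ξ * ‖v ξ‖ ^ 2) (boundaryMeasure r) :=
    integrable_of_continuous ((continuous_rootDensity γ).mul (hv.norm.pow 2))
  simp only [smul_eq_mul] at i1
  rw [← h1, ← integral_add i1 i2, ← integral_const_mul]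
  refine norm_integral_le_of_norm_le ((i1.add i2).const_mul _) (ae_of_all _ fun ξ => ?_)
  rw [norm_smul, norm_mul, RCLike.norm_conj, Real.norm_of_nonneg (rootDensity_nonneg γ ξ)]
  have h2 := mul_nonneg (rootDensity_nonneg γ ξ) (sq_nonneg (‖u (γ⁻¹ • ξ)‖ - ‖v ξ‖))
  linarith

theorem average_integral_rootDensity {F : Boundary r → ℝ} (hF : Continuous F) (n : ℕ) :
    ((sphere r n).card : ℝ)⁻¹ * ∑ γ ∈ sphere r n,
      ∫ ξ, rootDensity γ ξ * F ξ ∂boundaryMeasure r = ∫ ξ, F ξ ∂boundaryMeasure r := by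
  rw [← integral_finsetSum (f := fun γ ξ => rootDensity γ ξ * F ξ) _ fun γ _ =>
    integrable_of_continuous ((continuous_rootDensity γ).mul hF), ← integral_const_mul]
  congr 1
  funext ξ
  rw [← Finset.sum_mul, ← mul_assoc, average_rootDensity, one_mul]

/-- The Schur-type estimate `|⟨Mₙ(f) g, h⟩| ≤ C (‖g‖² + ‖h‖²) / 2`: the kernel of `Mₙ(1)` is
nonnegative and has both marginals equal to the boundary measure. -/
theorem norm_inner_average_le {f : C(Compactification r, ℂ)} {n : ℕ} {C : ℝ} (hC0 : 0 ≤ C)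
    (hC : ∀ γ ∈ sphere r n, ‖orbitValue f γ‖ ≤ C) {g h : L2 r} (hg : g ∈ cylindrical r)
    (hh : h ∈ cylindrical r) :
    ‖inner ℂ h (average f n g)‖ ≤ C * (1 / 2 * (‖g‖ ^ 2 + ‖h‖ ^ 2)) := by
  obtain ⟨k, u, hu, hgu⟩ := hg
  obtain ⟨l, v, hv, hhv⟩ := hh
  rw [inner_average, norm_sq_eq_integral hgu, norm_sq_eq_integral hhv,
    ← average_integral_rootDensity (F := fun ξ => ‖u ξ‖ ^ 2) (hu.continuous.norm.pow 2) n,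
    ← average_integral_rootDensity (F := fun ξ => ‖v ξ‖ ^ 2) (hv.continuous.norm.pow 2) n,
    ← sum_sphere_inv n fun γ => ∫ ξ, rootDensity γ ξ * ‖u ξ‖ ^ 2 ∂boundaryMeasure r,
    ← mul_add, ← Finset.sum_add_distrib, norm_mul, norm_inv, Complex.norm_natCast]
  calc _ ≤ ((sphere r n).card : ℝ)⁻¹ * ∑ γ ∈ sphere r n, C * (1 / 2 *
        (∫ ξ, rootDensity γ⁻¹ ξ * ‖u ξ‖ ^ 2 ∂boundaryMeasure r +
          ∫ ξ, rootDensity γ ξ * ‖v ξ‖ ^ 2 ∂boundaryMeasure r)) := by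
        refine mul_le_mul_of_nonneg_left ((norm_sum_le _ _).trans ?_) (by positivity)
        refine Finset.sum_le_sum fun γ hγ => ?_
        rw [inner_quasiRegular_div hgu hhv, norm_mul]
        exact mul_le_mul (hC γ hγ) (norm_matrixCoeff_le γ hu.continuous hv.continuous)
          (norm_nonneg _) hC0
    _ = _ := by
        rw [← Finset.mul_sum, ← Finset.mul_sum]
        ring

/-- For `γ = η₁ ⋯ ηₙ` the matrix coefficient of `u` and `v` is close to the value at `(γ⁻¹, γ)` of
`u ⊗ v̄`. -/
theorem norm_matrixCoeff_sub_le (hr : 1 ≤ r) {k : ℕ} {u v : Boundary r → ℂ}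
    (hu : DependsOnPrefix k u) (hv : DependsOnPrefix k v) {C D : ℝ} (hC : ∀ ξ, ‖u ξ‖ ≤ C)
    (hD : ∀ ξ, ‖v ξ‖ ≤ D) (n : ℕ) (η : Boundary r) :
    ‖matrixCoeff (η.pre n) u v - u (η.rev n) * starRingEnd ℂ (v η)‖ ≤
      (2 * (r : ℝ) - 1) ^ k / overlapMass r n * (4 * (C * D)) := by
  set γ := η.pre n with hγ
  -- the `u` part of the error is the one of `γ⁻¹`, after a change of variables
  have hinv : γ⁻¹ = (η.rev n).pre n := η.inv_pre n
  have hC0 : 0 ≤ C := (norm_nonneg _).trans (hC η)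
  have hD0 : 0 ≤ D := (norm_nonneg _).trans (hD η)
  have hU : Continuous fun ξ => ‖u ξ - u (η.rev n)‖ := (hu.continuous.sub continuous_const).norm
  have h1 := integral_rootDensity_smul γ hU.stronglyMeasurable
  have i1 := (integrable_rootDensity_smul γ hU).const_mul D
  simp only [smul_eq_mul] at h1 i1
  have i2 : Integrable (fun ξ => C * (rootDensity γ ξ * ‖v ξ - v η‖)) (boundaryMeasure r) :=
    integrable_of_continuous (continuous_const.mul ((continuous_rootDensity γ).mul
      (hv.continuous.sub continuous_const).norm))
  have hc : u (η.rev n) * starRingEnd ℂ (v η) =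
      ∫ ξ, rootDensity γ ξ • (u (η.rev n) * starRingEnd ℂ (v η)) ∂boundaryMeasure r := by
    rw [integral_smul_const, integral_rootDensity hr, one_smul]
  have i3 : Integrable (fun ξ => rootDensity γ ξ • (u (γ⁻¹ • ξ) * starRingEnd ℂ (v ξ)))
      (boundaryMeasure r) := by
    have := (integrable_rootDensity_smul γ hu.continuous).mul_bdd (c := D)
      (Complex.continuous_conj.comp hv.continuous).aestronglyMeasurable
      (ae_of_all _ fun ξ => by rw [Function.comp_apply, RCLike.norm_conj]; exact hD ξ)
    simpa only [smul_mul_assoc, Function.comp_apply] using this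
  have i4 : Integrable (fun ξ => rootDensity γ ξ • (u (η.rev n) * starRingEnd ℂ (v η)))
      (boundaryMeasure r) :=
    integrable_of_continuous ((continuous_rootDensity γ).smul continuous_const)
  rw [hc, matrixCoeff, ← integral_sub i3 i4]
  refine (norm_integral_le_of_norm_le (i1.add i2) (ae_of_all _ fun ξ => ?_)).trans ?_
  · rw [← smul_sub, norm_smul, Real.norm_of_nonneg (rootDensity_nonneg γ ξ)]
    have e : u (γ⁻¹ • ξ) * starRingEnd ℂ (v ξ) - u (η.rev n) * starRingEnd ℂ (v η) =
        (u (γ⁻¹ • ξ) - u (η.rev n)) * starRingEnd ℂ (v ξ) +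
          u (η.rev n) * starRingEnd ℂ (v ξ - v η) := by
      rw [map_sub]
      ring
    have h2 : ‖u (γ⁻¹ • ξ) * starRingEnd ℂ (v ξ) - u (η.rev n) * starRingEnd ℂ (v η)‖ ≤
        ‖u (γ⁻¹ • ξ) - u (η.rev n)‖ * D + C * ‖v ξ - v η‖ := by
      rw [e]
      refine (norm_add_le _ _).trans ?_
      rw [norm_mul, norm_mul, RCLike.norm_conj, RCLike.norm_conj]
      exact add_le_add (mul_le_mul_of_nonneg_left (hD ξ) (norm_nonneg _))
        (mul_le_mul_of_nonneg_right (hC _) (norm_nonneg _))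
    refine (mul_le_mul_of_nonneg_left h2 (rootDensity_nonneg γ ξ)).trans (le_of_eq ?_)
    simp only [Pi.add_apply]
    ring
  · simp only [Pi.add_apply]
    rw [integral_add i1 i2, integral_const_mul, integral_const_mul, h1, hinv, hγ]
    have h3 := mul_le_mul_of_nonneg_left
      (integral_rootDensity_norm_sub_le hr hu hC n (η.rev n)) hD0
    have h4 := mul_le_mul_of_nonneg_left (integral_rootDensity_norm_sub_le hr hv hD n η) hC0
    linarith

/-- Inversion permutes the sphere of radius `k`, so reading prefixes backwards preserves the
integral. -/
theorem integral_comp_rev (hr : 1 ≤ r) {k : ℕ} {u : Boundary r → ℂ} (hu : DependsOnPrefix k u) :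
    ∫ ξ, u (ξ.rev k) ∂boundaryMeasure r = ∫ ξ, u ξ ∂boundaryMeasure r := by
  obtain ⟨F, hF⟩ : ∃ F : FreeGroup (Fin r) → ℂ, ∀ ξ : Boundary r, u ξ = F (ξ.pre k) := by
    have hfac : u.FactorsThrough fun ξ : Boundary r => ξ.pre k :=
      fun ξ ζ h => hu ξ ζ (Boundary.pre_eq_iff.1 h)
    exact ⟨_, fun ξ => (hfac.extend_apply 0 ξ).symm⟩
  simp only [hF, ← Boundary.inv_pre]
  rw [← average_sphere hr k F, ← average_sphere hr k fun γ => F γ⁻¹, sum_sphere_inv]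

theorem inner_limitOperator (hr : 1 ≤ r) (f : C(Compactification r, ℂ)) {g h : L2 r}
    {u v : Boundary r → ℂ} (hg : g =ᵐ[boundaryMeasure r] u) (hh : h =ᵐ[boundaryMeasure r] v) :
    inner ℂ h (limitOperator f g) =
      (∫ ξ, restrictBoundary f ξ * starRingEnd ℂ (v ξ) ∂boundaryMeasure r) *
        ∫ ξ, u ξ ∂boundaryMeasure r := by
  have := isProbabilityMeasure_boundaryMeasure hr
  have h1 : ‖(Lp.const 2 (boundaryMeasure r) (1 : ℂ) : L2 r)‖ = 1 := by
    have := norm_sq_eq_integral (Lp.coeFn_const 2 (boundaryMeasure r) (1 : ℂ))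
    rw [← pow_eq_one_iff_of_nonneg (norm_nonneg _) two_ne_zero, this]
    simp
  have h2 : inner ℂ (Lp.const 2 (boundaryMeasure r) (1 : ℂ) : L2 r) g =
      ∫ ξ, u ξ ∂boundaryMeasure r := by
    rw [L2.inner_def]
    refine integral_congr_ae ?_
    filter_upwards [hg, Lp.coeFn_const 2 (boundaryMeasure r) (1 : ℂ)] with ξ e1 e2
    rw [e1, e2, RCLike.inner_apply]
    simp
  have h3 : inner ℂ h (mulOperator (restrictBoundary f)
      (Lp.const 2 (boundaryMeasure r) (1 : ℂ) : L2 r)) =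
      ∫ ξ, restrictBoundary f ξ * starRingEnd ℂ (v ξ) ∂boundaryMeasure r := by
    rw [L2.inner_def]
    refine integral_congr_ae ?_
    filter_upwards [hh, Lp.coeFn_const 2 (boundaryMeasure r) (1 : ℂ),
      (ContinuousLinearMap.mul ℂ ℂ).coeFn_holder (r := 2)
        (ContinuousMap.toLp ∞ (boundaryMeasure r) ℂ (restrictBoundary f))
        (Lp.const 2 (boundaryMeasure r) (1 : ℂ) : L2 r),
      ContinuousMap.coeFn_toLp (p := ∞) (𝕜 := ℂ) (boundaryMeasure r) (restrictBoundary f)]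
      with ξ e1 e2 e3 e4
    have e5 : (mulOperator (restrictBoundary f)
      (Lp.const 2 (boundaryMeasure r) (1 : ℂ) : L2 r)) ξ = restrictBoundary f ξ * 1 := by
      refine e3.trans ?_
      rw [e4, e2]
      rfl
    rw [e1, e5, RCLike.inner_apply, mul_one]
  rw [limitOperator, ContinuousLinearMap.comp_apply, constProjection,
    Submodule.starProjection_unit_singleton ℂ h1, map_smul, inner_smul_right, h2, h3, mul_comm]

/-! ### Weak convergence -/

/-- Weak convergence of a bounded sequence of operators can be checked on a dense set. -/
theorem tendsto_inner_of_dense {H : Type*} [NormedAddCommGroup H] [InnerProductSpace ℂ H]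
    {T : ℕ → H →L[ℂ] H} {S : H →L[ℂ] H} {C : ℝ} (hT : ∀ᶠ n in atTop, ‖T n‖ ≤ C) {D : Set H}
    (hD : Dense D)
    (h : ∀ x ∈ D, ∀ y ∈ D, Tendsto (fun n => inner ℂ y (T n x)) atTop (𝓝 (inner ℂ y (S x))))
    (x y : H) : Tendsto (fun n => inner ℂ y (T n x)) atTop (𝓝 (inner ℂ y (S x))) := by
  -- replacing `T n` by `T n - S` reduces to the case of the limit `0`
  set R : ℕ → H →L[ℂ] H := fun n => T n - S with hR
  set K := |C| + ‖S‖ + 1 with hK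
  have hK0 : 0 < K := by positivity
  have hRK : ∀ᶠ n in atTop, ‖R n‖ ≤ K := by
    filter_upwards [hT] with n hn
    have := norm_sub_le (T n) S
    have := le_abs_self C
    linarith
  have key : ∀ x y : H, Tendsto (fun n => inner ℂ y (T n x)) atTop (𝓝 (inner ℂ y (S x))) ↔
      Tendsto (fun n => ‖inner ℂ y (R n x)‖) atTop (𝓝 0) := by
    intro x y
    rw [tendsto_iff_norm_sub_tendsto_zero]
    simp only [hR, sub_apply, inner_sub_right]
  simp only [key] at h ⊢
  have bound : ∀ n, ‖R n‖ ≤ K → ∀ x y : H, ‖inner ℂ y (R n x)‖ ≤ K * (‖x‖ * ‖y‖) := by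
    intro n hn x y
    calc ‖inner ℂ y (R n x)‖ ≤ ‖y‖ * ‖R n x‖ := norm_inner_le_norm _ _
      _ ≤ ‖y‖ * (K * ‖x‖) :=
        mul_le_mul_of_nonneg_left ((R n).le_of_opNorm_le hn x) (norm_nonneg _)
      _ = _ := by ring
  have step1 : ∀ x ∈ D, ∀ y, Tendsto (fun n => ‖inner ℂ y (R n x)‖) atTop (𝓝 0) := by
    intro x hx y
    rw [Metric.tendsto_atTop]
    intro ε hε
    obtain ⟨y', hy', hyy⟩ := Metric.dense_iff.1 hD y (ε / (2 * K * (‖x‖ + 1))) (by positivity)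
    rw [Metric.mem_ball, dist_comm, dist_eq_norm] at hy'
    obtain ⟨N, hN⟩ := eventually_atTop.1 (hRK.and ((h x hx y' hyy).eventually
      (gt_mem_nhds (half_pos hε))))
    refine ⟨N, fun n hn => ?_⟩
    obtain ⟨h1, h2⟩ := hN n hn
    have h3 := bound n h1 x (y - y')
    have h4 : K * (‖x‖ * ‖y - y'‖) ≤ ε / 2 := by
      calc K * (‖x‖ * ‖y - y'‖) ≤ K * ((‖x‖ + 1) * (ε / (2 * K * (‖x‖ + 1)))) := by
            gcongr
            linarith
        _ = ε / 2 := by field_simp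
    rw [inner_sub_left] at h3
    have h5 := norm_sub_norm_le (inner ℂ y (R n x)) (inner ℂ y' (R n x))
    rw [Real.dist_0_eq_abs, abs_norm]
    linarith
  rw [Metric.tendsto_atTop]
  intro ε hε
  obtain ⟨x', hx', hxx⟩ := Metric.dense_iff.1 hD x (ε / (2 * K * (‖y‖ + 1))) (by positivity)
  rw [Metric.mem_ball, dist_comm, dist_eq_norm] at hx'
  obtain ⟨N, hN⟩ := eventually_atTop.1 (hRK.and ((step1 x' hxx y).eventually
    (gt_mem_nhds (half_pos hε))))
  refine ⟨N, fun n hn => ?_⟩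
  obtain ⟨h1, h2⟩ := hN n hn
  have h3 := bound n h1 (x - x') y
  have h4 : K * (‖x - x'‖ * ‖y‖) ≤ ε / 2 := by
    calc K * (‖x - x'‖ * ‖y‖) ≤ K * (ε / (2 * K * (‖y‖ + 1)) * (‖y‖ + 1)) := by
          gcongr
          linarith
      _ = ε / 2 := by field_simp
  rw [map_sub, inner_sub_right] at h3
  have h5 := norm_sub_norm_le (inner ℂ y (R n x)) (inner ℂ y (R n x'))
  rw [Real.dist_0_eq_abs, abs_norm]
  linarith

/-- An operator is bounded by `C` if its matrix coefficients on a dense set are bounded by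
`C (‖x‖² + ‖y‖²) / 2`. -/
theorem opNorm_le_of_dense {H : Type*} [NormedAddCommGroup H] [InnerProductSpace ℂ H]
    {T : H →L[ℂ] H} {C : ℝ} (hC : 0 ≤ C) {D : Set H} (hD : Dense D)
    (h : ∀ x ∈ D, ∀ y ∈ D, ‖inner ℂ y (T x)‖ ≤ C * (1 / 2 * (‖x‖ ^ 2 + ‖y‖ ^ 2))) : ‖T‖ ≤ C := by
  have hall : ∀ p : H × H, ‖inner ℂ p.2 (T p.1)‖ ≤ C * (1 / 2 * (‖p.1‖ ^ 2 + ‖p.2‖ ^ 2)) := by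
    intro p
    have hcl : IsClosed {p : H × H | ‖inner ℂ p.2 (T p.1)‖ ≤
        C * (1 / 2 * (‖p.1‖ ^ 2 + ‖p.2‖ ^ 2))} :=
      isClosed_le (by fun_prop) (by fun_prop)
    exact hcl.closure_subset_iff.2 (fun q hq => h q.1 hq.1 q.2 hq.2) ((hD.prod hD) p)
  refine T.opNorm_le_bound hC fun x => ?_
  rcases eq_or_ne (T x) 0 with h0 | h0
  · rw [h0, norm_zero]
    positivity
  have hTx : 0 < ‖T x‖ := norm_pos_iff.2 h0
  have hx : 0 < ‖x‖ := norm_pos_iff.2 fun hx => h0 (by rw [hx, map_zero])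
  -- test against the multiple of `T x` that has the norm of `x`
  have h1 := hall (x, ((‖x‖ / ‖T x‖ : ℝ) : ℂ) • T x)
  have h2 : ‖((‖x‖ / ‖T x‖ : ℝ) : ℂ) • T x‖ = ‖x‖ := by
    rw [norm_smul, Complex.norm_real, norm_div, norm_norm, norm_norm, div_mul_cancel₀ _ hTx.ne']
  have h3 : ‖inner ℂ (((‖x‖ / ‖T x‖ : ℝ) : ℂ) • T x) (T x)‖ = ‖x‖ * ‖T x‖ := by
    rw [inner_smul_left, norm_mul, RCLike.norm_conj, inner_self_eq_norm_sq_to_K, Complex.norm_real,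
      norm_div, norm_norm, norm_norm, norm_pow]
    simp only [Complex.coe_algebraMap, Complex.norm_real, norm_norm]
    field_simp
  simp only [h2, h3] at h1
  refine le_of_mul_le_mul_left ?_ hx
  linarith

theorem exists_norm_average_le (hr : 1 ≤ r) (f : C(Compactification r, ℂ)) :
    ∃ C, ∀ᶠ n in atTop, ‖average f n‖ ≤ C := by
  obtain ⟨C, hC, hfC⟩ := continuous_bounded (restrictBoundary f).continuous
  obtain ⟨N, hN⟩ := exists_orbitValue_sub_lt f zero_lt_one
  refine ⟨C + 1, eventually_atTop.2 ⟨N, fun n hn => opNorm_le_of_dense (by positivity)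
    (dense_cylindrical r) fun g hg h hh => norm_inner_average_le (by positivity) (fun γ hγ => ?_)
      hg hh⟩⟩
  obtain ⟨ξ, rfl⟩ := exists_pre_eq_of_mem_sphere hr hγ
  have h1 := hN n hn ξ
  have h2 := norm_sub_norm_le (orbitValue f (ξ.pre n)) (restrictBoundary f ξ)
  linarith [hfC ξ]

theorem tendsto_inner_average_of_cylindrical (hr : 2 ≤ r) (f : C(Compactification r, ℂ))
    {g h : L2 r} (hg : g ∈ cylindrical r) (hh : h ∈ cylindrical r) :
    Tendsto (fun n => inner ℂ h (average f n g)) atTop (𝓝 (inner ℂ h (limitOperator f g))) := by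
  have hr1 : 1 ≤ r := by omega
  have := isProbabilityMeasure_boundaryMeasure hr1
  obtain ⟨k₁, u, hu, hgu⟩ := hg
  obtain ⟨k₂, v, hv, hhv⟩ := hh
  obtain ⟨k, hk₁, hk₂⟩ : ∃ k, k₁ ≤ k ∧ k₂ ≤ k := ⟨_, le_max_left _ _, le_max_right _ _⟩
  replace hu := hu.mono hk₁
  replace hv := hv.mono hk₂
  obtain ⟨Cu, hCu, huC⟩ := continuous_bounded hu.continuous
  obtain ⟨Cv, hCv, hvC⟩ := continuous_bounded hv.continuous
  obtain ⟨Cf, hCf, hfC⟩ := continuous_bounded (restrictBoundary f).continuous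
  set A : Boundary r → ℂ := fun ξ => restrictBoundary f ξ * starRingEnd ℂ (v ξ)
  have hA : Continuous A :=
    (restrictBoundary f).continuous.mul (Complex.continuous_conj.comp hv.continuous)
  -- the limit of the integrals in which all the matrix coefficients are replaced by point values
  have hmix : Tendsto (fun n : ℕ => ∫ ξ, A ξ * u (ξ.rev n) ∂boundaryMeasure r) atTop
      (𝓝 (inner ℂ h (limitOperator f g))) := by
    rw [inner_limitOperator hr1 f hgu hhv, ← integral_comp_rev hr1 hu,
      ← tendsto_add_atTop_iff_nat k]
    refine (tendsto_integral_mul_comp_shift hr hA hu.comp_rev.continuous).congr fun m => ?_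
    congr 1
    funext ξ
    rw [hu.rev_eq (show k ≤ m + k by omega), Nat.add_sub_cancel]
  have havg : ∀ n, inner ℂ h (average f n g) =
      ∫ ξ, orbitValue f (ξ.pre n) * matrixCoeff (ξ.pre n) u v ∂boundaryMeasure r := by
    intro n
    rw [inner_average, ← average_sphere hr1 n fun γ => orbitValue f γ * matrixCoeff γ u v,
      Complex.real_smul]
    simp only [inner_quasiRegular_div hgu hhv]
    push_cast
    rfl
  have hdiff : Tendsto (fun n : ℕ => inner ℂ h (average f n g) -
      ∫ ξ, A ξ * u (ξ.rev n) ∂boundaryMeasure r) atTop (𝓝 0) := by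
    rw [Metric.tendsto_atTop]
    intro ε hε
    obtain ⟨N₁, hN₁⟩ := exists_orbitValue_sub_lt f
      (show 0 < min 1 (ε / (3 * (Cu * Cv + 1))) by positivity)
    have hlim : Tendsto (fun n => (2 * (r : ℝ) - 1) ^ k / overlapMass r n * (4 * (Cu * Cv)))
        atTop (𝓝 0) := by
      simpa using ((tendsto_overlapMass hr).const_div_atTop ((2 * (r : ℝ) - 1) ^ k)).mul_const
        (4 * (Cu * Cv))
    obtain ⟨N₂, hN₂⟩ := eventually_atTop.1 (hlim.eventually (gt_mem_nhds
      (show 0 < ε / (3 * (Cf + 1)) by positivity)))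
    refine ⟨max N₁ N₂, fun n hn => ?_⟩
    have h1 := hN₁ n ((le_max_left _ _).trans hn)
    have h2 := hN₂ n ((le_max_right _ _).trans hn)
    rw [dist_zero_right, havg, ← integral_sub (f := fun ξ : Boundary r =>
      orbitValue f (ξ.pre n) * matrixCoeff (ξ.pre n) u v) (g := fun ξ => A ξ * u (ξ.rev n))]
    · refine (norm_integral_le_of_norm_le_const (C := 2 * ε / 3) (ae_of_all _ fun ξ => ?_)).trans_lt
        (by rw [probReal_univ]; linarith)
      have e : orbitValue f (ξ.pre n) * matrixCoeff (ξ.pre n) u v - A ξ * u (ξ.rev n) =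
          orbitValue f (ξ.pre n) *
            (matrixCoeff (ξ.pre n) u v - u (ξ.rev n) * starRingEnd ℂ (v ξ)) +
          (orbitValue f (ξ.pre n) - restrictBoundary f ξ) *
            (u (ξ.rev n) * starRingEnd ℂ (v ξ)) := by
        simp only [A]
        ring
      rw [e]
      refine (norm_add_le _ _).trans ?_
      rw [norm_mul, norm_mul, norm_mul, RCLike.norm_conj]
      have h3 : ‖orbitValue f (ξ.pre n)‖ ≤ Cf + 1 := by
        have := norm_sub_norm_le (orbitValue f (ξ.pre n)) (restrictBoundary f ξ)
        have := (h1 ξ).trans_le (min_le_left _ _)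
        linarith [hfC ξ]
      have h4 := (norm_matrixCoeff_sub_le hr1 hu hv huC hvC n ξ).trans h2.le
      have h5 : ‖orbitValue f (ξ.pre n) - restrictBoundary f ξ‖ ≤ ε / (3 * (Cu * Cv + 1)) :=
        ((h1 ξ).trans_le (min_le_right _ _)).le
      have h6 : ‖u (ξ.rev n)‖ * ‖v ξ‖ ≤ Cu * Cv + 1 :=
        (mul_le_mul (huC _) (hvC _) (norm_nonneg _) hCu).trans (by linarith)
      calc _ ≤ (Cf + 1) * (ε / (3 * (Cf + 1))) + ε / (3 * (Cu * Cv + 1)) * (Cu * Cv + 1) :=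
            add_le_add (mul_le_mul h3 h4 (norm_nonneg _) (by positivity))
              (mul_le_mul h5 h6 (by positivity) (by positivity))
        _ = 2 * ε / 3 := by
            field_simp
            ring
    · exact integrable_of_continuous (dependsOnPrefix_comp_pre n
        fun γ => orbitValue f γ * matrixCoeff γ u v).continuous
    · refine integrable_of_continuous (hA.mul (hu.continuous.comp ?_))
      exact continuous_boundary_iff.2 fun i =>
        (continuous_of_discreteTopology (f := invLetter)).comp (continuous_coord (n - 1 - i))
  simpa using hdiff.add hmix

theorem tendsto_inner_average (hr : 2 ≤ r) (f : C(Compactification r, ℂ)) (g h : L2 r) :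
    Tendsto (fun n => inner ℂ h (average f n g)) atTop (𝓝 (inner ℂ h (limitOperator f g))) := by
  obtain ⟨C, hC⟩ := exists_norm_average_le (show 1 ≤ r by omega) f
  exact tendsto_inner_of_dense hC (dense_cylindrical r)
    (fun _ hg _ hh => tendsto_inner_average_of_cylindrical hr f hg hh) g h

end FreeBoundary

end

open Filter Topology FreeBoundary
theorem mainTheorem2 (r : ℕ) (hr : 2 ≤ r) (f : C(Compactification r, ℂ)) :
    Tendsto (fun n : ℕ => ContinuousLinearMapWOT.ofCLM (average f n)) atTop
        (𝓝 (ContinuousLinearMapWOT.ofCLM (limitOperator f))) ∧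
      ∀ g h : L2 r,
        Tendsto (fun n : ℕ => ((FreeBoundary.sphere r n).card : ℂ)⁻¹ *
            ∑ γ ∈ FreeBoundary.sphere r n, f (Compactification.ofTree (γ • basePoint r)) *
              (inner ℂ h (quasiRegular r γ g) / (harishChandra γ : ℂ))) atTop
          (𝓝 (inner ℂ h (limitOperator f g))) := by
  refine ⟨ContinuousLinearMapWOT.tendsto_iff_forall_inner_apply_tendsto.2
    fun g h => tendsto_inner_average hr f g h, fun g h => ?_⟩
  exact (tendsto_inner_average hr f g h).congr fun n => inner_average f n g h
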